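/- **Setting.** Let $X$ be a finite multiset (indexed family) of non-zero vectors that spans $\mathbb{R}^n$, with a fixed linear order $\prec$ on its elements; subsets of $X$ are subsets of the index set. Let $\Pi=\mathbb{C}[t_1,\dots,t_n]$, and let $\Pi^0_j$ be its homogeneous part of degree $j$. For $x\in\mathbb{R}^n$ put $p_x(t)=x\cdot t$, and for a finite multiset $Y$ of vectors put $p_Y=\prod_{y\in Y}p_y$. For $p\in\Pi$ let $p(D)$ be the differential operator obtained by substituting $\partial/\partial t_i$ for $t_i$. Put $\langle p,q\rangle=(p(D)q)(0)$, and for an ideal $J\subset\Pi$ put $\ker J=\{q\in\Pi: p(D)q=0\ \text{for all } p\in J\}$. Let $\mathbb{I}(X)$ be the collection of linearly independent subsets of $X$, and let $\mathbb{I}'\subset\mathbb{I}(X)$ be *semi-external*: if $I\in\mathbb{I}'$, $I'\in\mathbb{I}(X)$ and $\operatorname{span} I\subset\operatorname{span} I'$, then $I'\in\mathbb{I}'$. For $I\in\mathbb{I}(X)$ put $$X(I)=\{x\in X\setminus I:\ x\notin\operatorname{span}\{b\in I: b\prec x\}\},\qquad \operatorname{val}(I)=\#X(I),\qquad Q_I=p_{X(I)}.$$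 Let $B_0$ be an ordered basis of $\mathbb{R}^n$ and let $X'=X\sqcup B_0$ (multiset union). For $I\in\mathbb{I}(X)$ let $\operatorname{ex}(I)\subset X'$ consist of $I$ and of those $b\in B_0$ with $b\notin\operatorname{span}(I\cup\{b'\in B_0: b'\prec b\})$; this is a basis of $\mathbb{R}^n$. Define $$\mathcal{P}_+(X,\mathbb{I}')=\operatorname{span}\{p_Y: Y\subset X,\ Y\cap I=\emptyset\text{ for some } I\in\mathbb{I}'\},$$ $$\mathcal{J}_+(X,\mathbb{I}')=\operatorname{Ideal}\{p_Y: Y\subset X',\ Y\cap\operatorname{ex}(I)\neq\emptyset\text{ for all } I\in\mathbb{I}'\},\qquad \mathcal{D}_+(X,\mathbb{I}')=\ker\mathcal{J}_+(X,\mathbb{I}').$$ A *facet hyperplane* of $X$ is an $(n-1)$-dimensional subspace spanned by elements of $X$. For a subspace $S$ let $\#(X\setminus S)$ be the number of elements of $X$ outside $S$, and let $\Pi^0_j(S\perp)=\{p\in\Pi^0_j: D_\eta p=0\text{ for all }\eta\in S\}$, where $D_\eta$ is the directional derivative. Let $\mathcal{I}_+(X)$ be the ideal generated by the polynomials $p_{\eta}^{\#(X\setminus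 F)+1}$, where $F$ is a facet hyperplane of $X$ and $\eta\neq0$ is normal to $F$, and let $$\mathcal{I}_+(X,\mathbb{I}')=\mathcal{I}_+(X)+\operatorname{Ideal}\bigcup\{\Pi^0_{\#(X\setminus S)}(S\perp):\ S=\operatorname{span} I,\ I\in\mathbb{I}(X)\setminus\mathbb{I}'\}.$$ For $\lambda\in\mathbb{R}^{X'}$ let $\mathcal{H}(X',\lambda)$ be the arrangement of the hyperplanes $H_b=\{t\in\mathbb{R}^n: b\cdot t=\lambda_b\}$, $b\in X'$. It is *simple* if any $m$ of these hyperplanes (counted with multiplicity) have an intersection that is either empty or of codimension $m$. In that case let $V(\mathbb{I}')$ be the set of the vertices $\bigcap_{b\in\operatorname{ex}(I)}H_b$, $I\in\mathbb{I}'$. For a finite set $V\subset\mathbb{R}^n$ let $\operatorname{Exp}(V)$ be the complex span of the functions $t\mapsto e^{v\cdot t}$, $v\in V$. For $0\ne f\in\operatorname{Exp}(V)$ let $f_\downarrow$ be the first non-zero term in the expansion of $f$ into homogeneous polynomials, and let $\Pi(V)=\operatorname{span}\{f_\downarrow: 0\neq f\in\operatorname{Exp}(V)\}$. **Theorem.**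 1. The polynomials $(Q_I)_{I\in\mathbb{I}'}$ form a basis of $\mathcal{P}_+(X,\mathbb{I}')$. In particular $\dim\mathcal{P}_+(X,\mathbb{I}')=\#\mathbb{I}'$, and for every $j\ge0$, $$\dim(\mathcal{P}_+(X,\mathbb{I}')\cap\Pi^0_j)=\#\{I\in\mathbb{I}':\operatorname{val}(I)=j\}.$$ 2. For every $\lambda$ for which $\mathcal{H}(X',\lambda)$ is simple, $\mathcal{D}_+(X,\mathbb{I}')=\Pi(V(\mathbb{I}'))$. Moreover $\dim\mathcal{D}_+(X,\mathbb{I}')=\#\mathbb{I}'$. 3. $\mathcal{J}_+(X,\mathbb{I}')\oplus\mathcal{P}_+(X,\mathbb{I}')=\Pi$. 4. $\mathcal{P}_+(X,\mathbb{I}')=\ker\mathcal{I}_+(X,\mathbb{I}')$. 5. The map $p\mapsto\langle p,\cdot\rangle$ is an isomorphism between $\mathcal{P}_+(X,\mathbb{I}')$ and the dual space $\mathcal{D}_+(X,\mathbb{I}')^*$. -/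

import Mathlib

namespace Zonotopal

/-- The Euclidean space `ℝⁿ`. -/
abbrev E (n : ℕ) : Type := EuclideanSpace ℝ (Fin n)

/-- The polynomial ring `Π = ℂ[t₁, …, tₙ]`. -/
abbrev Poly (n : ℕ) : Type := MvPolynomial (Fin n) ℂ

section Polynomials

variable {n : ℕ}

/-- The linear form `p_x(t) = x · t`. -/
noncomputable def linForm (x : E n) : Poly n :=
  ∑ i, MvPolynomial.C ((x i : ℝ) : ℂ) * MvPolynomial.X i

/-- The product `p_Y = ∏_{y ∈ Y} p_y` over a subset `Y` of (the index set of) a family of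
vectors. -/
noncomputable def prodForm {κ : Type*} (x : κ → E n) (Y : Finset κ) : Poly n :=
  ∏ y ∈ Y, linForm (x y)

/-- The differential operator `∂^α = (∂/∂t₁)^(α₁) ⋯ (∂/∂tₙ)^(αₙ)`. -/
noncomputable def monomialDiffOp (α : Fin n →₀ ℕ) : Module.End ℂ (Poly n) :=
  ((List.finRange n).map fun i =>
    ((MvPolynomial.pderiv i : Derivation ℂ (Poly n) (Poly n)) : Module.End ℂ (Poly n)) ^ α i).prod

/-- The differential operator `p(D) = ∑_α p_α ∂^α`, as a linear function of `p = ∑_α p_α t^α`. -/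
noncomputable def diffOp : Poly n →ₗ[ℂ] Module.End ℂ (Poly n) :=
  (MvPolynomial.basisMonomials (Fin n) ℂ).constr ℂ monomialDiffOp

/-- The bilinear pairing `⟨p, q⟩ = (p(D) q)(0)`. -/
noncomputable def pairing : Poly n →ₗ[ℂ] Poly n →ₗ[ℂ] ℂ :=
  diffOp.compr₂ (MvPolynomial.aeval (0 : Fin n → ℂ)).toLinearMap

/-- The kernel of an ideal: `ker I = {q | p(D) q = 0 for all p ∈ I}`. -/
noncomputable def idealKer (I : Ideal (Poly n)) : Submodule ℂ (Poly n) where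
  carrier := {q | ∀ p ∈ I, diffOp p q = 0}
  add_mem' ha hb p hp := by rw [map_add, ha p hp, hb p hp, add_zero]
  zero_mem' p _ := map_zero _
  smul_mem' c q hq p hp := by rw [map_smul, hq p hp, smul_zero]

/-- `Π⁰_j(S⊥)`: the homogeneous polynomials of degree `j` on the orthogonal complement of `S`,
that is, those whose derivatives in the directions of `S` vanish. -/
def homogPerp (S : Submodule ℝ (E n)) (j : ℕ) : Set (Poly n) :=
  {p | p.IsHomogeneous j ∧ ∀ η ∈ S, diffOp (linForm η) p = 0}

end Polynomials

section Least

variable {n : ℕ}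

/-- The exponential `e_v : t ↦ exp (v · t)` with frequency `v`. -/
noncomputable def expFun (v : E n) : E n → ℂ :=
  fun t => Complex.exp ((inner ℝ v t : ℝ) : ℂ)

/-- `Exp(V)`, the complex span of the exponentials with frequencies in `V`. -/
noncomputable def expSpace (V : Set (E n)) : Submodule ℂ (E n → ℂ) :=
  Submodule.span ℂ (expFun '' V)

/-- `p` is the least term `f↓` of `f`: the first non-zero term of the expansion
`f = f₀ + f₁ + f₂ + ⋯` of `f` into homogeneous polynomials `f_j` of degree `j`. -/
def IsLeastTerm (f : E n → ℂ) (p : Poly n) : Prop :=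
  ∃ (g : ℕ → Poly n) (j₀ : ℕ),
    (∀ j, (g j).IsHomogeneous j) ∧
    (∀ t : E n, HasSum (fun j => MvPolynomial.eval (fun i => ((t i : ℝ) : ℂ)) (g j)) (f t)) ∧
    (∀ j < j₀, g j = 0) ∧ g j₀ ≠ 0 ∧ p = g j₀

/-- The least space `Π(V) = span {f↓ : f ∈ Exp(V) \ {0}}`. -/
noncomputable def leastSpace (V : Set (E n)) : Submodule ℂ (Poly n) :=
  Submodule.span ℂ {p | ∃ f ∈ expSpace V, f ≠ 0 ∧ IsLeastTerm f p}

end Least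

section Arrangements

variable {n : ℕ} {κ : Type*}

/-- The hyperplane `H_{x,c} = {t | x · t = c}`. -/
def hyperplane (x : E n) (c : ℝ) : Set (E n) :=
  {t | inner ℝ x t = c}

/-- The intersection of the hyperplanes `H_{x_b,c_b}`, `b ∈ s`. -/
def flat (x : κ → E n) (c : κ → ℝ) (s : Finset κ) : Set (E n) :=
  ⋂ b ∈ s, hyperplane (x b) (c b)

/-- The arrangement of the hyperplanes `H_{x_b,c_b}` is simple: every `m` of the hyperplanes have
either an empty intersection or an intersection of codimension `m`. -/
def IsSimpleArrangement (x : κ → E n) (c : κ → ℝ) : Prop :=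
  ∀ s : Finset κ, flat x c s = ∅ ∨
    Module.finrank ℝ (vectorSpan ℝ (flat x c s)) + s.card = n

end Arrangements

section SemiExternal

variable {n : ℕ} {ι : Type*}

/-- The linear span of the vectors indexed by `I`. -/
def spanOf (X : ι → E n) (I : Set ι) : Submodule ℝ (E n) :=
  Submodule.span ℝ (X '' I)

/-- `𝕀(X)`, the collection of the independent subsets of the multiset `X`. -/
def indepSets (X : ι → E n) : Set (Finset ι) :=
  {I | LinearIndepOn ℝ X (I : Set ι)}

/-- `𝕀' ⊆ 𝕀(X)` is semi-external: it is closed under passing to an independent set whose span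
is at least as large. -/
def IsSemiExternal (X : ι → E n) (II : Set (Finset ι)) : Prop :=
  II ⊆ indepSets X ∧
    ∀ I ∈ II, ∀ I' ∈ indepSets X, spanOf X (I : Set ι) ≤ spanOf X (I' : Set ι) → I' ∈ II

/-- `#(X \ S)`, the number of vectors of the multiset `X` outside the subspace `S`. -/
noncomputable def numOutside (X : ι → E n) (S : Submodule ℝ (E n)) : ℕ :=
  {i | X i ∉ S}.ncard

/-- `F` is a facet hyperplane of `X`: a subspace of dimension `n - 1` spanned by vectors of
`X`. -/
def IsFacet (X : ι → E n) (F : Submodule ℝ (E n)) : Prop :=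
  (∃ Y : Finset ι, F = spanOf X (Y : Set ι)) ∧ Module.finrank ℝ F + 1 = n

/-- The external ideal `ℐ₊(X)`, generated by the powers `p_η ^ (m(F) + 1)`, where `η` is normal
to a facet hyperplane `F` and `m(F) = #(X \ F)`. -/
noncomputable def idealI (X : ι → E n) : Ideal (Poly n) :=
  Ideal.span {p | ∃ F η, IsFacet X F ∧ η ∈ Fᗮ ∧ η ≠ 0 ∧ p = linForm η ^ (numOutside X F + 1)}

/-- The semi-external ideal `ℐ₊(X, 𝕀')`: the sum of `ℐ₊(X)` and the ideal generated by the
`Π⁰_{#(X \ S)}(S⊥)`, where `S` runs through the spans of the sets in `𝕀(X) \ 𝕀'`. -/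
noncomputable def idealISemi (X : ι → E n) (II : Set (Finset ι)) : Ideal (Poly n) :=
  idealI X ⊔ Ideal.span {p | ∃ I ∈ indepSets X \ II,
    p ∈ homogPerp (spanOf X (I : Set ι)) (numOutside X (spanOf X (I : Set ι)))}

/-- `𝒫₊(X, 𝕀')`, spanned by the `p_Y` for which `Y ⊆ X` misses some `I ∈ 𝕀'`. -/
noncomputable def spaceP (X : ι → E n) (II : Set (Finset ι)) : Submodule ℂ (Poly n) :=
  Submodule.span ℂ {p | ∃ Y : Finset ι, (∃ I ∈ II, Disjoint Y I) ∧ p = prodForm X Y}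

/-- The augmented multiset `X' = X ⊔ B₀`. -/
noncomputable def augment (X : ι → E n) (B₀ : Module.Basis (Fin n) ℝ (E n)) : ι ⊕ Fin n → E n :=
  Sum.elim X B₀

open Classical in
/-- The greedy completion `ex(I)` of an independent `I ⊆ X` by elements of the ordered basis
`B₀`: an element `b` of `B₀` is taken if it lies outside the span of `I` and the elements of `B₀`
before `b`. -/
noncomputable def ex (X : ι → E n) (B₀ : Module.Basis (Fin n) ℝ (E n)) (I : Finset ι) :
    Finset (ι ⊕ Fin n) :=
  I.disjSum (Finset.univ.filter fun b : Fin n =>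
    B₀ b ∉ Submodule.span ℝ (X '' (I : Set ι) ∪ B₀ '' {b' | b' < b}))

/-- The ideal `𝒥₊(X, 𝕀')`, generated by the `p_Y` for which `Y ⊆ X'` meets `ex(I)` for every
`I ∈ 𝕀'`. -/
noncomputable def idealJ (X : ι → E n) (B₀ : Module.Basis (Fin n) ℝ (E n))
    (II : Set (Finset ι)) : Ideal (Poly n) :=
  Ideal.span {p | ∃ Y : Finset (ι ⊕ Fin n),
    (∀ I ∈ II, ¬ Disjoint Y (ex X B₀ I)) ∧ p = prodForm (augment X B₀) Y}

/-- `𝒟₊(X, 𝕀') = ker 𝒥₊(X, 𝕀')`. -/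
noncomputable def spaceD (X : ι → E n) (B₀ : Module.Basis (Fin n) ℝ (E n))
    (II : Set (Finset ι)) : Submodule ℂ (Poly n) :=
  idealKer (idealJ X B₀ II)

/-- `V(𝕀')`, the vertices of the arrangement `ℋ(X', c)` that correspond to the bases `ex(I)`,
`I ∈ 𝕀'`. -/
def vertices (X : ι → E n) (B₀ : Module.Basis (Fin n) ℝ (E n)) (c : ι ⊕ Fin n → ℝ)
    (II : Set (Finset ι)) : Set (E n) :=
  {v | ∃ I ∈ II, flat (augment X B₀) c (ex X B₀ I) = {v}}

variable [Fintype ι] [LinearOrder ι]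

open Classical in
/-- `X(I)`, the set of all `x ∈ X \ I` outside the span of the elements of `I` before `x`. -/
noncomputable def outerSet (X : ι → E n) (I : Finset ι) : Finset ι :=
  Finset.univ.filter fun x => x ∉ I ∧ X x ∉ spanOf X {b | b ∈ I ∧ b < x}

/-- The valuation `val(I) = #X(I)`. -/
noncomputable def val (X : ι → E n) (I : Finset ι) : ℕ :=
  (outerSet X I).card

/-- The polynomial `Q_I = p_{X(I)}`. -/
noncomputable def polyQ (X : ι → E n) (I : Finset ι) : Poly n :=
  prodForm X (outerSet X I)

end SemiExternal

end Zonotopal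

/-! Parts 1, 2, 3 and 5 follow from one chain of inequalities, `#𝕀' ≤ dim Π(V(𝕀')) ≤ dim 𝒟₊ ≤ dim 𝒫₊
≤ #𝕀'`, in which equality must hold throughout. The last inequality is a straightening argument
(`prodForm_mem_span_polyQ`): exchanging factors of `p_Y` for earlier vectors writes it in terms of
the `Q_I`. For the third, `𝒥₊ + 𝒫₊ = Π` (`idealJ_sup_spaceP`), so an element of `ker 𝒥₊` that pairs
to zero with `𝒫₊` vanishes. For the second, a generator `p_Y(D)` annihilates least terms, because a
product of operators `D_b - λ_b`, `b ∈ Y`, annihilates every exponential at a vertex of `V(𝕀')`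
(`diffOp_prodForm_expTerm`). The first counts least terms degree by degree; simplicity makes the
vertices distinct, and simple arrangements exist because finitely many proper subspaces do not cover
a vector space.

Part 4 is proved by deletion and contraction, for the minors in which a set `A` is contracted and
only the vectors of `T` remain. Contracting `A` means working modulo the linear forms of `span A`,
that is, restricting polynomials to `(span A)ᗮ`. If `f` satisfies the differential conditions for `T
∪ {x}`, then modulo `p_x` it satisfies those of the contraction and is known by induction; the
remainder is `p_x g`, and `g` satisfies the conditions of the deletion (`MinorKer.delete`). The
induction is `MinorKer.mem_sup`. -/

namespace Zonotopal

open MvPolynomial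

/-! ### Constant-coefficient differential operators and the pairing -/

section DiffOp

variable {n : ℕ}

theorem commute_pderiv (i j : Fin n) :
    Commute ((pderiv i : Derivation ℂ (Poly n) (Poly n)) : Module.End ℂ (Poly n))
      ((pderiv j : Derivation ℂ (Poly n) (Poly n)) : Module.End ℂ (Poly n)) := by
  refine LinearMap.ext fun p => ?_
  ext m
  simp only [Module.End.mul_apply, Derivation.coeFn_coe, coeff_pderiv]
  rw [add_right_comm]
  by_cases h : i = j
  · subst h; ring
  · simp [h, Ne.symm h]
    ring

theorem _root_.List.prod_map_mul_of_commute {α M : Type*} [Monoid M] (l : List α) (f g : α → M)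
    (h : ∀ a b, Commute (f a) (g b)) :
    (l.map fun a => f a * g a).prod = (l.map f).prod * (l.map g).prod := by
  induction l with
  | nil => simp
  | cons a l ih =>
    have : Commute (l.map f).prod (g a) := by
      refine Commute.list_prod_left _ _ fun x hx => ?_
      obtain ⟨b, -, rfl⟩ := List.mem_map.1 hx
      exact h b a
    simp only [List.map_cons, List.prod_cons, ih]
    rw [mul_assoc, mul_assoc, ← mul_assoc (g a), ← this.eq, mul_assoc]

theorem monomialDiffOp_zero : monomialDiffOp (0 : Fin n →₀ ℕ) = 1 := by
  simp [monomialDiffOp]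

theorem monomialDiffOp_add (α β : Fin n →₀ ℕ) :
    monomialDiffOp (α + β) = monomialDiffOp α * monomialDiffOp β := by
  unfold monomialDiffOp
  rw [← List.prod_map_mul_of_commute _ _ _ fun i j => (commute_pderiv i j).pow_pow _ _]
  simp [pow_add]

theorem monomialDiffOp_single (i : Fin n) :
    monomialDiffOp (Finsupp.single i 1) =
      ((pderiv i : Derivation ℂ (Poly n) (Poly n)) : Module.End ℂ (Poly n)) := by
  unfold monomialDiffOp
  rw [List.prod_map_eq_pow_single i]
  · simp [List.count_eq_one_of_mem (List.nodup_finRange n)]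
  · intro j hj _
    simp [Ne.symm hj]

theorem diffOp_monomial (α : Fin n →₀ ℕ) (a : ℂ) :
    diffOp (monomial α a) = a • monomialDiffOp α := by
  have : (monomial α a : Poly n) = a • basisMonomials (Fin n) ℂ α := by
    simp [smul_monomial]
  rw [this, map_smul, diffOp, Module.Basis.constr_basis]

theorem diffOp_mul (p q : Poly n) : diffOp (p * q) = diffOp p * diffOp q := by
  induction p using MvPolynomial.induction_on' with
  | add p₁ p₂ h₁ h₂ => rw [add_mul, map_add, h₁, h₂, map_add, add_mul]
  | monomial α a =>
    induction q using MvPolynomial.induction_on' with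
    | add p₁ p₂ h₁ h₂ => rw [mul_add, map_add, h₁, h₂, map_add, mul_add]
    | monomial β b =>
      rw [monomial_mul, diffOp_monomial, diffOp_monomial, diffOp_monomial, monomialDiffOp_add,
        smul_mul_smul_comm]

theorem diffOp_mul_apply (p q r : Poly n) : diffOp (p * q) r = diffOp p (diffOp q r) := by
  rw [diffOp_mul, Module.End.mul_apply]

theorem diffOp_C (a : ℂ) : diffOp (C a : Poly n) = a • 1 := by
  rw [← monomial_zero', diffOp_monomial, monomialDiffOp_zero]

theorem diffOp_one : diffOp (1 : Poly n) = 1 := by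
  simpa using diffOp_C (n := n) 1

theorem diffOp_X (i : Fin n) (p : Poly n) : diffOp (X i) p = pderiv i p := by
  rw [MvPolynomial.X, diffOp_monomial, monomialDiffOp_single, one_smul, Derivation.coeFn_coe]

theorem diffOp_comm (p q r : Poly n) : diffOp p (diffOp q r) = diffOp q (diffOp p r) := by
  rw [← diffOp_mul_apply, ← diffOp_mul_apply, mul_comm]

theorem diffOp_pow_succ_apply (p r : Poly n) (k : ℕ) :
    diffOp (p ^ (k + 1)) r = diffOp (p ^ k) (diffOp p r) := by
  rw [pow_succ, diffOp_mul_apply]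

/-- The constant is a product of positive integers, hence non-zero in characteristic zero. This
gives both the vanishing of `q(D)` on lower degrees and the nondegeneracy of the pairing. -/
theorem exists_coeff_monomialDiffOp (α : Fin n →₀ ℕ) :
    ∀ m : Fin n →₀ ℕ, ∃ c : ℂ, c ≠ 0 ∧
      ∀ p : Poly n, coeff m (monomialDiffOp α p) = coeff (m + α) p * c := by
  induction α using Finsupp.induction_linear with
  | zero => exact fun m => ⟨1, one_ne_zero, fun p => by simp [monomialDiffOp_zero]⟩
  | add α β hα hβ =>
    intro m
    obtain ⟨c, hc, h⟩ := hα m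
    obtain ⟨d, hd, h'⟩ := hβ (m + α)
    refine ⟨d * c, mul_ne_zero hd hc, fun p => ?_⟩
    rw [monomialDiffOp_add, Module.End.mul_apply, h, h', add_assoc, mul_assoc]
  | single i k =>
    induction k with
    | zero => exact fun m => ⟨1, one_ne_zero, fun p => by simp [monomialDiffOp_zero]⟩
    | succ k ih =>
      intro m
      obtain ⟨c, hc, h⟩ := ih m
      refine ⟨(((m + Finsupp.single i k) i : ℕ) + 1) * c,
        mul_ne_zero (Nat.cast_add_one_ne_zero _) hc, fun p => ?_⟩
      rw [Finsupp.single_add, monomialDiffOp_add, Module.End.mul_apply, h, monomialDiffOp_single,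
        Derivation.coeFn_coe, coeff_pderiv, add_assoc, mul_assoc]

theorem diffOp_eq_zero_of_totalDegree_lt {q r : Poly n} {m : ℕ} (hq : q.IsHomogeneous m)
    (hr : r.totalDegree < m) : diffOp q r = 0 := by
  rw [q.as_sum, map_sum, LinearMap.sum_apply]
  refine Finset.sum_eq_zero fun α hα => ?_
  have hdeg : α.degree = m := by
    by_contra h
    exact (mem_support_iff.1 hα) (hq.coeff_eq_zero h)
  rw [diffOp_monomial, LinearMap.smul_apply]
  convert smul_zero _
  ext m'
  obtain ⟨c, -, h⟩ := exists_coeff_monomialDiffOp α m'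
  rw [h, coeff_eq_zero_of_totalDegree_lt, zero_mul, coeff_zero]
  have : (m' + α).degree = m'.degree + α.degree := map_add _ _ _
  change r.totalDegree < (m' + α).degree
  omega

theorem pairing_apply (p q : Poly n) : pairing p q = coeff 0 (diffOp p q) := by
  simp [pairing, LinearMap.compr₂_apply, constantCoeff_eq]

theorem eq_zero_of_forall_pairing_eq_zero {q : Poly n} (h : ∀ p, pairing p q = 0) : q = 0 := by
  ext α
  obtain ⟨c, hc, h'⟩ := exists_coeff_monomialDiffOp α 0
  have := h (monomial α 1)
  rw [pairing_apply, diffOp_monomial, one_smul, h', zero_add] at this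
  simpa [hc] using this

theorem mem_idealKer_span {s : Set (Poly n)} {q : Poly n} :
    q ∈ idealKer (Ideal.span s) ↔ ∀ p ∈ s, diffOp p q = 0 := by
  refine ⟨fun h p hp => h p (Ideal.subset_span hp), fun h p hp => ?_⟩
  induction hp using Submodule.span_induction with
  | mem x hx => exact h x hx
  | zero => simp
  | add x y _ _ hx hy => simp [hx, hy]
  | smul a x _ hx => rw [smul_eq_mul, diffOp_mul_apply, hx, map_zero]

theorem mem_idealKer_sup {I J : Ideal (Poly n)} {q : Poly n} :
    q ∈ idealKer (I ⊔ J) ↔ q ∈ idealKer I ∧ q ∈ idealKer J := by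
  refine ⟨fun h => ⟨fun p hp => h p (le_sup_left (a := I) hp),
    fun p hp => h p (le_sup_right (a := I) hp)⟩, fun h p hp => ?_⟩
  obtain ⟨a, ha, b, hb, rfl⟩ := Submodule.mem_sup.1 hp
  rw [map_add, LinearMap.add_apply, h.1 a ha, h.2 b hb, add_zero]

end DiffOp

/-! ### Linear forms and their commutators with differential operators -/

section LinForm

variable {n : ℕ}

theorem linForm_add (x y : E n) : linForm (x + y) = linForm x + linForm y := by
  simp [linForm, add_mul, Finset.sum_add_distrib]

theorem linForm_smul (a : ℝ) (x : E n) : linForm (a • x) = (a : ℂ) • linForm x := by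
  simp [linForm, Finset.smul_sum, mul_assoc, smul_eq_C_mul]

/-- `x ↦ p_x` as a real linear map. -/
noncomputable def linFormₗ : E n →ₗ[ℝ] Poly n where
  toFun := linForm
  map_add' := linForm_add
  map_smul' a x := by
    rw [linForm_smul]
    exact (Complex.coe_smul a (linForm x))

theorem linForm_zero : linForm (0 : E n) = 0 := map_zero (linFormₗ (n := n))

theorem isHomogeneous_linForm (x : E n) : (linForm x).IsHomogeneous 1 :=
  IsHomogeneous.sum _ _ _ fun _ _ => isHomogeneous_C_mul_X _ _

theorem isHomogeneous_prodForm {κ : Type*} (x : κ → E n) (Y : Finset κ) :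
    (prodForm x Y).IsHomogeneous Y.card := by
  have := IsHomogeneous.prod Y (fun y => linForm (x y)) (fun _ => 1)
    fun y _ => isHomogeneous_linForm (x y)
  simpa [prodForm] using this

theorem linForm_single (i : Fin n) : linForm (EuclideanSpace.single i (1 : ℝ)) = X i := by
  unfold linForm
  rw [Finset.sum_eq_single i]
  · simp
  · intro j _ hj; simp [hj]
  · simp

theorem diffOp_linForm (x : E n) (p : Poly n) :
    diffOp (linForm x) p = ∑ i, C ((x i : ℝ) : ℂ) * pderiv i p := by
  simp [linForm, map_sum, LinearMap.sum_apply, diffOp_mul_apply, diffOp_C, diffOp_X,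
    smul_eq_C_mul]

theorem diffOp_linForm_mul (x : E n) (p q : Poly n) :
    diffOp (linForm x) (p * q) = diffOp (linForm x) p * q + p * diffOp (linForm x) q := by
  simp only [diffOp_linForm, pderiv_mul, Finset.sum_mul, Finset.mul_sum, ← Finset.sum_add_distrib]
  exact Finset.sum_congr rfl fun i _ => by ring

theorem diffOp_linForm_linForm (x y : E n) :
    diffOp (linForm x) (linForm y) = C ((inner ℝ x y : ℝ) : ℂ) := by
  rw [diffOp_linForm]
  have : ∀ i, pderiv i (linForm y) = C ((y i : ℝ) : ℂ) := by
    intro i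
    simp only [linForm, map_sum, pderiv_C_mul]
    rw [Finset.sum_eq_single i]
    · simp
    · intro j _ hj; simp [pderiv_X_of_ne hj]
    · simp
  simp only [this, ← C_mul, ← map_sum, PiLp.inner_apply]
  congr 1
  push_cast
  exact Finset.sum_congr rfl fun i _ => by simp [mul_comm]

theorem diffOp_linForm_C (x : E n) (a : ℂ) : diffOp (linForm x) (C a) = 0 := by
  simp [diffOp_linForm]

/-- The commutator of `q(D)` and the multiplication by `p_x` is `(D_x q)(D)`. -/
theorem diffOp_linForm_mul_apply (q : Poly n) (x : E n) (r : Poly n) :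
    diffOp q (linForm x * r) = linForm x * diffOp q r + diffOp (diffOp (linForm x) q) r := by
  induction q using MvPolynomial.induction_on generalizing r with
  | C a =>
    simp [diffOp_C, diffOp_linForm_C]
  | add p q hp hq => simp only [map_add, LinearMap.add_apply, hp, hq]; ring
  | mul_X p i hp =>
    rw [diffOp_mul_apply, ← linForm_single, diffOp_linForm_mul, diffOp_linForm_linForm, map_add,
      hp, diffOp_linForm_mul, diffOp_linForm_linForm, map_add, LinearMap.add_apply,
      diffOp_mul_apply, diffOp_mul_apply, ← smul_eq_C_mul, map_smul, mul_comm p, ← smul_eq_C_mul,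
      map_smul, LinearMap.smul_apply, real_inner_comm]
    ring

/-- All the commutators vanish, so the factors `p_y` behave as constants for `q(D)`. -/
theorem diffOp_prodForm_mul_apply {κ : Type*} (x : κ → E n) {Y : Finset κ} {q : Poly n}
    (hq : ∀ y ∈ Y, diffOp (linForm (x y)) q = 0) (r : Poly n) :
    diffOp q (prodForm x Y * r) = prodForm x Y * diffOp q r := by
  classical
  induction Y using Finset.induction_on generalizing r with
  | empty => simp [prodForm]
  | insert a Y ha ih =>
    have h : ∀ r, prodForm x (insert a Y) * r = linForm (x a) * (prodForm x Y * r) := fun r => by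
      rw [prodForm, Finset.prod_insert ha, prodForm, mul_assoc]
    rw [h, h, diffOp_linForm_mul_apply, ih fun y hy => hq y (Finset.mem_insert_of_mem hy),
      hq a (Finset.mem_insert_self a Y)]
    simp

end LinForm

/-! ### Greedy bases with respect to the order on `X` -/

section Greedy

variable {n : ℕ} {ι : Type*} (X : ι → E n)

theorem spanOf_mono {s t : Set ι} (h : s ⊆ t) : spanOf X s ≤ spanOf X t :=
  Submodule.span_mono (Set.image_mono h)

theorem mem_spanOf {s : Set ι} {i : ι} (h : i ∈ s) : X i ∈ spanOf X s :=
  Submodule.subset_span (Set.mem_image_of_mem X h)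

theorem spanOf_le {s : Set ι} {S : Submodule ℝ (E n)} : spanOf X s ≤ S ↔ ∀ i ∈ s, X i ∈ S := by
  rw [spanOf, Submodule.span_le, Set.image_subset_iff]
  rfl

theorem spanOf_empty : spanOf X ∅ = ⊥ := by simp [spanOf]

variable [LinearOrder ι]

theorem linearIndepOn_of_notMem_spanOf_lt (s : Finset ι)
    (h : ∀ x ∈ s, X x ∉ spanOf X {b | b ∈ s ∧ b < x}) : LinearIndepOn ℝ X (s : Set ι) := by
  induction s using Finset.induction_on_max with
  | empty => simp
  | insert a s ha ih =>
    rw [Finset.coe_insert]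
    have hset : {b | b ∈ insert a s ∧ b < a} = (s : Set ι) := by
      ext b
      constructor
      · rintro ⟨hb, hlt⟩
        exact (Finset.mem_insert.1 hb).resolve_left hlt.ne
      · exact fun hb => ⟨Finset.mem_insert_of_mem hb, ha b hb⟩
    refine (ih fun x hx hmem => h x (Finset.mem_insert_of_mem hx) ?_).insert ?_
    · refine spanOf_mono X ?_ hmem
      exact fun b hb => ⟨Finset.mem_insert_of_mem hb.1, hb.2⟩
    · have := h a (Finset.mem_insert_self a s)
      rwa [hset] at this

open Classical in
/-- The lexicographically first maximal independent subset of `Z`. -/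
noncomputable def greedy (Z : Finset ι) : Finset ι :=
  Z.filter fun x => X x ∉ spanOf X {b | b ∈ Z ∧ b < x}

theorem mem_greedy {Z : Finset ι} {x : ι} :
    x ∈ greedy X Z ↔ x ∈ Z ∧ X x ∉ spanOf X {b | b ∈ Z ∧ b < x} := by
  simp [greedy]

theorem greedy_subset (Z : Finset ι) : greedy X Z ⊆ Z := fun _ hx => ((mem_greedy X).1 hx).1

theorem greedy_mem_indepSets (Z : Finset ι) : greedy X Z ∈ indepSets X := by
  refine linearIndepOn_of_notMem_spanOf_lt X _ fun x hx hmem => ?_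
  refine ((mem_greedy X).1 hx).2 (spanOf_mono X ?_ hmem)
  exact fun b hb => ⟨greedy_subset X Z hb.1, hb.2⟩

variable [Finite ι]

/-- A rejected element depends on earlier elements of `Z`, which by well-founded induction depend on
earlier elements of the greedy basis. -/
theorem spanOf_lt_le_greedy (Z : Finset ι) (x : ι) :
    spanOf X {b | b ∈ Z ∧ b < x} ≤ spanOf X {b | b ∈ greedy X Z ∧ b < x} := by
  induction x using WellFoundedLT.induction with
  | ind x ih =>
    rw [spanOf_le]
    rintro b ⟨hb, hlt⟩
    by_cases hg : b ∈ greedy X Z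
    · exact mem_spanOf X ⟨hg, hlt⟩
    · have : X b ∈ spanOf X {b' | b' ∈ Z ∧ b' < b} := by
        by_contra hcon
        exact hg ((mem_greedy X).2 ⟨hb, hcon⟩)
      refine spanOf_mono X ?_ (ih b hlt this)
      exact fun b' hb' => ⟨hb'.1, hb'.2.trans hlt⟩

theorem mem_spanOf_greedy_lt {Z : Finset ι} {x : ι} (hx : x ∈ Z) (hg : x ∉ greedy X Z) :
    X x ∈ spanOf X {b | b ∈ greedy X Z ∧ b < x} := by
  refine spanOf_lt_le_greedy X Z x ?_
  by_contra hcon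
  exact hg ((mem_greedy X).2 ⟨hx, hcon⟩)

theorem spanOf_greedy (Z : Finset ι) : spanOf X (greedy X Z : Set ι) = spanOf X (Z : Set ι) := by
  refine le_antisymm (spanOf_mono X (greedy_subset X Z)) ((spanOf_le X).2 fun x hx => ?_)
  by_cases hg : x ∈ greedy X Z
  · exact mem_spanOf X hg
  · exact spanOf_mono X (fun b hb => hb.1) (mem_spanOf_greedy_lt X hx hg)

end Greedy

/-! ### Straightening: the `Q_I` span `𝒫₊` -/

section Spanning

variable {n : ℕ} {ι : Type*} [Fintype ι] [LinearOrder ι] {X : ι → E n} {II : Set (Finset ι)}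

theorem mem_outerSet {I : Finset ι} {x : ι} :
    x ∈ outerSet X I ↔ x ∉ I ∧ X x ∉ spanOf X {b | b ∈ I ∧ b < x} := by
  simp [outerSet]

theorem prodForm_insert {κ : Type*} [DecidableEq κ] (x : κ → E n) {Y : Finset κ} {a : κ}
    (ha : a ∉ Y) : prodForm x (insert a Y) = linForm (x a) * prodForm x Y := by
  rw [prodForm, Finset.prod_insert ha, prodForm]

theorem IsSemiExternal.greedy_mem (hII : IsSemiExternal X II) {I : Finset ι} (hI : I ∈ II)
    {Z : Finset ι} (h : spanOf X (I : Set ι) ≤ spanOf X (Z : Set ι)) : greedy X Z ∈ II :=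
  hII.2 I hI _ (greedy_mem_indepSets X Z) (h.trans (spanOf_greedy X Z).ge)

theorem disjoint_greedy_compl (X : ι → E n) (Y : Finset ι) : Disjoint Y (greedy X Yᶜ) :=
  Finset.disjoint_left.2 fun _ hx hg => Finset.mem_compl.1 (greedy_subset X _ hg) hx

theorem IsSemiExternal.greedy_compl_mem (hII : IsSemiExternal X II) {I Y : Finset ι} (hI : I ∈ II)
    (hYI : Disjoint Y I) : greedy X Yᶜ ∈ II :=
  hII.greedy_mem hI (spanOf_mono X fun _ hi =>
    Finset.mem_compl.2 fun hY => Finset.disjoint_left.1 hYI hY hi)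

theorem polyQ_mem_spaceP {I : Finset ι} (hI : I ∈ II) : polyQ X I ∈ spaceP X II :=
  Submodule.subset_span ⟨outerSet X I, ⟨I, hI, Finset.disjoint_left.2 fun _ hx =>
    (mem_outerSet.1 hx).1⟩, rfl⟩

theorem outerSet_greedy_compl_subset (X : ι → E n) (Y : Finset ι) :
    outerSet X (greedy X Yᶜ) ⊆ Y := by
  intro x hx
  by_contra hY
  obtain ⟨hg, hs⟩ := mem_outerSet.1 hx
  exact hs (mem_spanOf_greedy_lt X (Finset.mem_compl.2 hY) hg)

/-- With `I` the greedy basis of the complement of `Y`, always `X(I) ⊆ Y`. In case of equality `p_Y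
= Q_I`. Otherwise some `z ∈ Y` depends on earlier elements `b` of `I`, and substituting for `p_z`
replaces `Y` by sets `Y \ {z} ∪ {b}`. The induction is on the sum `N` of the positions of the
elements of `Y`, which drops since `b < z`. -/
theorem prodForm_mem_span_polyQ (hII : IsSemiExternal X II) (N : ℕ) :
    ∀ Y : Finset ι, ∑ y ∈ Y, (Finset.univ.filter (· < y)).card = N → (∃ I ∈ II, Disjoint Y I) →
      prodForm X Y ∈ Submodule.span ℂ (Set.range fun I : II => polyQ X (I : Finset ι)) := by
  induction N using Nat.strong_induction_on with
  | _ N ih =>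
  rintro Y hN ⟨I₀, hI₀, hYI₀⟩
  have hI := hII.greedy_compl_mem hI₀ hYI₀
  have hYI := disjoint_greedy_compl X Y
  have hsub := outerSet_greedy_compl_subset X Y
  generalize hgI : greedy X Yᶜ = I at *
  by_cases hY : Y ⊆ outerSet X I
  · rw [Finset.Subset.antisymm hY hsub]
    exact Submodule.subset_span ⟨⟨I, hI⟩, rfl⟩
  obtain ⟨z, hzY, hz⟩ := Finset.not_subset.1 hY
  have hzI : z ∉ I := Finset.disjoint_left.1 hYI hzY
  have hzspan : X z ∈ spanOf X ((I.filter (· < z) : Finset ι) : Set ι) := by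
    by_contra hcon
    refine hz (mem_outerSet.2 ⟨hzI, ?_⟩)
    simpa using hcon
  obtain ⟨c, hc⟩ := (Submodule.mem_span_image_finset_iff_exists_fun' ℝ).1 hzspan
  have hprod : prodForm X Y = ∑ b ∈ I.filter (· < z),
      (c b : ℂ) • prodForm X (insert b (Y.erase z)) := by
    rw [← Finset.insert_erase hzY, prodForm_insert X (Finset.notMem_erase z Y)]
    have : linForm (X z) = ∑ b ∈ I.filter (· < z), (c b : ℂ) • linForm (X b) := by
      rw [← hc]
      simp only [← linForm_smul]
      exact map_sum (linFormₗ (n := n)) _ _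
    rw [this, Finset.sum_mul]
    refine Finset.sum_congr rfl fun b hb => ?_
    have hbY : b ∉ Y := Finset.disjoint_right.1 hYI (Finset.mem_filter.1 hb).1
    rw [Finset.erase_insert (Finset.notMem_erase z Y),
      prodForm_insert X (fun h => hbY (Finset.mem_of_mem_erase h)), smul_mul_assoc]
  rw [hprod]
  refine Submodule.sum_mem _ fun b hb => ?_
  obtain ⟨hbI, hbz⟩ := Finset.mem_filter.1 hb
  have hbY : b ∉ Y := Finset.disjoint_right.1 hYI hbI
  -- Only a non-zero coefficient allows the exchange of `b` for `z`: then `I \ {b} ∪ {z}`, which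
  -- misses the new set, still spans `I`.
  rcases eq_or_ne (c b) 0 with h0 | h0
  · simp [h0]
  refine Submodule.smul_mem _ _ (ih _ ?_ _ rfl ⟨_, hII.greedy_mem hI ?_,
    disjoint_greedy_compl X _⟩)
  · rw [← hN, Finset.sum_insert (fun h => hbY (Finset.mem_of_mem_erase h)),
      ← Finset.add_sum_erase Y _ hzY]
    refine Nat.add_lt_add_right (Finset.card_lt_card ?_) _
    refine ⟨fun a ha => ?_, fun h => ?_⟩
    · simp only [Finset.mem_filter, Finset.mem_univ, true_and] at ha ⊢
      exact ha.trans hbz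
    · have := h (show b ∈ _ by simpa using hbz)
      simp at this
  · have hother : ∀ a ∈ I, a ≠ b → X a ∈ spanOf X ((insert b (Y.erase z))ᶜ : Finset ι) := by
      intro a ha hab
      refine mem_spanOf X ?_
      have : a ∉ Y := Finset.disjoint_right.1 hYI ha
      simp [hab, this]
    rw [spanOf_le]
    intro a ha
    by_cases hab : a = b
    · subst hab
      have hza : X z ∈ spanOf X ((insert a (Y.erase z))ᶜ : Finset ι) := by
        refine mem_spanOf X ?_
        simp [hbz.ne']
      rw [← Finset.add_sum_erase _ _ hb, ← eq_sub_iff_add_eq] at hc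
      have hrest : ∀ i ∈ (I.filter (· < z)).erase a,
          c i • X i ∈ spanOf X ((insert a (Y.erase z))ᶜ : Finset ι) := fun i hi =>
        Submodule.smul_mem _ (c i) (hother i
          (Finset.filter_subset (· < z) I (Finset.mem_of_mem_erase hi)) (Finset.ne_of_mem_erase hi))
      have := Submodule.sub_mem _ hza (Submodule.sum_mem _ hrest)
      rw [← hc] at this
      exact (Submodule.smul_mem_iff _ h0).1 this
    · exact hother a ha hab

theorem span_polyQ (hII : IsSemiExternal X II) :
    Submodule.span ℂ (Set.range fun I : II => polyQ X (I : Finset ι)) = spaceP X II := by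
  refine le_antisymm (Submodule.span_le.2 ?_) (Submodule.span_le.2 ?_)
  · rintro _ ⟨I, rfl⟩
    exact polyQ_mem_spaceP I.2
  · rintro _ ⟨Y, hY, rfl⟩
    exact prodForm_mem_span_polyQ hII _ Y rfl hY

end Spanning

/-! ### The completions `ex(I)` are bases -/

section Completion

variable {n : ℕ} {ι : Type*} {X : ι → E n} (B₀ : Module.Basis (Fin n) ℝ (E n))

theorem inl_mem_ex {I : Finset ι} {i : ι} : Sum.inl i ∈ ex X B₀ I ↔ i ∈ I := by
  simp [ex, Finset.inl_mem_disjSum]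

theorem inr_mem_ex {I : Finset ι} {b : Fin n} : Sum.inr b ∈ ex X B₀ I ↔
    B₀ b ∉ Submodule.span ℝ (X '' (I : Set ι) ∪ B₀ '' {b' | b' < b}) := by
  simp [ex, Finset.inr_mem_disjSum]

theorem ex_injective : Function.Injective (ex X B₀) := by
  intro I I' h
  ext i
  rw [← inl_mem_ex B₀ (X := X), h, inl_mem_ex]

theorem spanOf_augment_ex (I : Finset ι) : spanOf (augment X B₀) (ex X B₀ I : Set _) = ⊤ := by
  rw [← top_le_iff, ← B₀.span_eq, Submodule.span_le]
  rintro _ ⟨b, rfl⟩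
  induction b using WellFoundedLT.induction with
  | ind b ih =>
    by_cases h : Sum.inr b ∈ ex X B₀ I
    · exact mem_spanOf (augment X B₀) (i := Sum.inr b) h
    · rw [inr_mem_ex, not_not] at h
      refine Submodule.span_le.2 ?_ h
      rintro _ (⟨i, hi, rfl⟩ | ⟨b', hb', rfl⟩)
      · exact mem_spanOf (augment X B₀) (i := Sum.inl i) ((inl_mem_ex B₀).2 hi)
      · exact ih b' hb'

theorem linearIndepOn_ex {I : Finset ι} (hI : I ∈ indepSets X) :
    LinearIndepOn ℝ (augment X B₀) (ex X B₀ I : Set (ι ⊕ Fin n)) := by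
  classical
  have hkey : ∀ t : Finset (Fin n), (∀ b ∈ t, Sum.inr b ∈ ex X B₀ I) →
      LinearIndepOn ℝ (augment X B₀) (Sum.inl '' (I : Set ι) ∪ Sum.inr '' (t : Set (Fin n))) := by
    intro t
    induction t using Finset.induction_on_max with
    | empty =>
      intro _
      rw [Finset.coe_empty, Set.image_empty, Set.union_empty]
      exact LinearIndepOn.image_of_comp Sum.inl (augment X B₀) hI
    | insert a t ha ih =>
      intro h
      rw [Finset.coe_insert, Set.image_insert_eq, Set.union_insert]
      refine (ih fun b hb => h b (Finset.mem_insert_of_mem hb)).insert fun hmem => ?_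
      refine (inr_mem_ex B₀).1 (h a (Finset.mem_insert_self a t)) (Submodule.span_mono ?_ hmem)
      rintro _ ⟨_, ⟨i, hi, rfl⟩ | ⟨b, hb, rfl⟩, rfl⟩
      · exact Or.inl ⟨i, hi, rfl⟩
      · exact Or.inr ⟨b, ha b hb, rfl⟩
  refine (hkey (Finset.univ.filter fun b => Sum.inr b ∈ ex X B₀ I) (by simp)).mono ?_
  rintro (i | b) hx
  · exact Or.inl ⟨i, (inl_mem_ex B₀).1 hx, rfl⟩
  · exact Or.inr ⟨b, by simpa using hx, rfl⟩

theorem card_ex {I : Finset ι} (hI : I ∈ indepSets X) : (ex X B₀ I).card = n := by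
  have h := finrank_span_eq_card (linearIndepOn_ex B₀ hI)
  have hr : Set.range (fun k : (ex X B₀ I : Set (ι ⊕ Fin n)) => augment X B₀ k) =
      augment X B₀ '' (ex X B₀ I : Set (ι ⊕ Fin n)) := by
    rw [Set.image_eq_range]
  rw [hr] at h
  change Module.finrank ℝ (spanOf (augment X B₀) _) = _ at h
  rw [spanOf_augment_ex, finrank_top, finrank_euclideanSpace_fin] at h
  simpa using h.symm

theorem disjoint_map_inl_ex {Y I : Finset ι} :
    Disjoint (Y.map Function.Embedding.inl) (ex X B₀ I) ↔ Disjoint Y I := by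
  simp [Finset.disjoint_left, inl_mem_ex]

theorem prodForm_map_inl (Y : Finset ι) :
    prodForm (augment X B₀) (Y.map Function.Embedding.inl) = prodForm X Y := by
  simp [prodForm, augment]

end Completion

/-! ### The decomposition `𝒥₊ + 𝒫₊ = Π` -/

section Sum

variable {n : ℕ} {ι : Type*} [Fintype ι] [LinearOrder ι] {X : ι → E n} {II : Set (Finset ι)}
  (B₀ : Module.Basis (Fin n) ℝ (E n))

/-- For a generator `p_Y` of `𝒫₊`, let `I` be the greedy basis of the complement of `Y`. Since
`ex(I)` spans, `η` may be taken in `ex(I)`. Each product is then again a generator, of `𝒫₊` or of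
`𝒥₊`. -/
theorem linForm_mul_mem_sup (hII : IsSemiExternal X II) (η : E n) {p : Poly n}
    (hp : p ∈ (idealJ X B₀ II).restrictScalars ℂ ⊔ spaceP X II) :
    linForm η * p ∈ (idealJ X B₀ II).restrictScalars ℂ ⊔ spaceP X II := by
  obtain ⟨a, ha, q, hq, rfl⟩ := Submodule.mem_sup.1 hp
  rw [mul_add]
  refine add_mem (Submodule.mem_sup_left (Ideal.mul_mem_left _ _ ha)) ?_
  induction hq using Submodule.span_induction with
  | zero => simp
  | add x y _ _ hx hy =>
    rw [mul_add]
    exact add_mem (hx (Submodule.add_mem_sup ha ‹_›)) (hy (Submodule.add_mem_sup ha ‹_›))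
  | smul c x _ hx =>
    rw [mul_smul_comm]
    exact Submodule.smul_mem _ c (hx (Submodule.add_mem_sup ha ‹_›))
  | mem x hx =>
    obtain ⟨Y, ⟨I₀, hI₀, hYI₀⟩, rfl⟩ := hx
    clear hp
    have hI := hII.greedy_compl_mem hI₀ hYI₀
    have hYI := disjoint_greedy_compl X Y
    have hspan := spanOf_greedy X Yᶜ
    generalize hgI : greedy X Yᶜ = I at *
    have hη : η ∈ spanOf (augment X B₀) (ex X B₀ I : Set _) := by
      rw [spanOf_augment_ex]; trivial
    induction hη using Submodule.span_induction with
    | zero => simp [linForm_zero]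
    | add x y _ _ hx hy => rw [linForm_add, add_mul]; exact add_mem hx hy
    | smul c x _ hx => rw [linForm_smul, smul_mul_assoc]; exact Submodule.smul_mem _ _ hx
    | mem x hx =>
      obtain ⟨i | b, hk, rfl⟩ := hx
      · have hiI : i ∈ I := (inl_mem_ex B₀).1 hk
        have hiY : i ∉ Y := Finset.disjoint_right.1 hYI hiI
        change linForm (X i) * prodForm X Y ∈ _
        rw [← prodForm_insert X hiY]
        by_cases h : ∃ I' ∈ II, Disjoint (insert i Y) I'
        · exact Submodule.mem_sup_right (Submodule.subset_span ⟨_, h, rfl⟩)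
        · push Not at h
          refine Submodule.mem_sup_left (Ideal.subset_span
            ⟨(insert i Y).map Function.Embedding.inl, fun I' hI' => ?_,
              (prodForm_map_inl B₀ _).symm⟩)
          rw [disjoint_map_inl_ex]
          exact h I' hI'
      -- If `I' ∈ 𝕀'` misses `Y`, then `span I' ≤ span I`. An element of `B₀` that the completion of
      -- `I` accepts is therefore accepted by that of `I'`, so `Y ∪ {b}` meets every `ex(I')`.
      · refine Submodule.mem_sup_left (Ideal.subset_span
          ⟨insert (Sum.inr b) (Y.map Function.Embedding.inl), fun I' hI' hdisj => ?_, ?_⟩)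
        · rw [Finset.disjoint_insert_left, disjoint_map_inl_ex] at hdisj
          refine hdisj.1 ((inr_mem_ex B₀).2 fun hmem => (inr_mem_ex B₀).1 hk ?_)
          have hle : spanOf X (I' : Set ι) ≤ spanOf X (I : Set ι) := by
            rw [hspan]
            exact spanOf_mono X fun i hi => Finset.mem_coe.2
              (Finset.mem_compl.2 (Finset.disjoint_right.1 hdisj.2 hi))
          rw [Submodule.span_union] at hmem ⊢
          exact sup_le_sup_right hle _ hmem
        · rw [prodForm_insert _ (by simp), prodForm_map_inl, augment, Sum.elim_inr]

theorem idealJ_sup_spaceP (hII : IsSemiExternal X II) :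
    (idealJ X B₀ II).restrictScalars ℂ ⊔ spaceP X II = ⊤ := by
  have hone : (1 : Poly n) ∈ (idealJ X B₀ II).restrictScalars ℂ ⊔ spaceP X II := by
    -- If `𝕀'` is empty, the condition on generators of `𝒥₊` is vacuous and `1 = p_∅` lies in `𝒥₊`;
    -- otherwise it lies in `𝒫₊`.
    rcases II.eq_empty_or_nonempty with rfl | ⟨I, hI⟩
    · exact Submodule.mem_sup_left (Ideal.subset_span ⟨∅, by simp, by simp [prodForm]⟩)
    · exact Submodule.mem_sup_right (Submodule.subset_span
        ⟨∅, ⟨I, hI, Finset.disjoint_empty_left I⟩, by simp [prodForm]⟩)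
  refine eq_top_iff.2 fun p _ => ?_
  induction p using MvPolynomial.induction_on with
  | C a => simpa [smul_eq_C_mul] using Submodule.smul_mem _ a hone
  | add p q hp hq => exact add_mem (hp trivial) (hq trivial)
  | mul_X p i hp =>
    rw [mul_comm, ← linForm_single]
    exact linForm_mul_mem_sup B₀ hII _ (hp trivial)

end Sum

/-! ### Exponential sums, their least terms and the dimension of the least space -/

section LeastSpace

variable {n : ℕ}

/-- The point `t ∈ ℝⁿ` as a point of `ℂⁿ`. -/
def complexify (t : E n) : Fin n → ℂ := fun i => ((t i : ℝ) : ℂ)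

theorem eval_linForm (x t : E n) : eval (complexify t) (linForm x) = ((inner ℝ x t : ℝ) : ℂ) := by
  simp [linForm, complexify, PiLp.inner_apply, mul_comm]

theorem eq_zero_of_forall_eval_complexify {p : Poly n}
    (h : ∀ t : E n, eval (complexify t) p = 0) : p = 0 := by
  refine MvPolynomial.funext_set (fun _ => Set.range ((↑) : ℝ → ℂ))
    (fun _ => Set.infinite_range_of_injective Complex.ofReal_injective) fun z hz => ?_
  choose s hs using fun i => hz i (Set.mem_univ i)
  have : z = complexify (WithLp.toLp 2 s : E n) := by
    ext i; simp [complexify, hs]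
  rw [this, h, map_zero]

theorem eval_complexify_smul {p : Poly n} {j : ℕ} (hp : p.IsHomogeneous j) (s : ℝ) (t : E n) :
    eval (complexify (s • t)) p = s ^ j • eval (complexify t) p := by
  have : complexify (s • t) = fun i => (s : ℂ) * complexify t i := by
    ext i; simp [complexify]
  rw [this, eval_eq', eval_eq', Finset.smul_sum]
  refine Finset.sum_congr rfl fun d hd => ?_
  have hdeg : ∑ i, d i = j := by
    rw [← Finsupp.degree_eq_sum]
    by_contra h
    exact mem_support_iff.1 hd (hp.coeff_eq_zero h)
  simp only [mul_pow, Finset.prod_mul_distrib, Finset.prod_pow_eq_pow_sum, hdeg,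
    Complex.real_smul, Complex.ofReal_pow]
  ring

theorem eq_zero_of_hasSum_pow_smul {a : ℕ → ℂ}
    (h : ∀ s : ℝ, HasSum (fun j => s ^ j • a j) 0) (j : ℕ) : a j = 0 := by
  let p : FormalMultilinearSeries ℝ ℝ ℂ := fun j => ContinuousMultilinearMap.mkPiRing ℝ (Fin j) (a j)
  have hp : HasFPowerSeriesAt (0 : ℝ → ℂ) p 0 := by
    rw [hasFPowerSeriesAt_iff]
    refine Filter.Eventually.of_forall fun s => ?_
    simpa [p, FormalMultilinearSeries.coeff] using h s
  have := congrArg (fun q : FormalMultilinearSeries ℝ ℝ ℂ => q.coeff j) hp.eq_zero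
  simpa [p, FormalMultilinearSeries.coeff] using this

/-- On each line through the origin the expansion is a power series in the line parameter, whose
coefficients are unique. This identifies the arbitrary expansion in `IsLeastTerm` with the
exponential series. -/
theorem homogeneous_expansion_unique {g g' : ℕ → Poly n} {f : E n → ℂ}
    (hg : ∀ j, (g j).IsHomogeneous j) (hg' : ∀ j, (g' j).IsHomogeneous j)
    (h : ∀ t, HasSum (fun j => eval (complexify t) (g j)) (f t))
    (h' : ∀ t, HasSum (fun j => eval (complexify t) (g' j)) (f t)) : g = g' := by
  ext1 j
  rw [← sub_eq_zero]
  refine eq_zero_of_forall_eval_complexify fun t => ?_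
  refine eq_zero_of_hasSum_pow_smul (a := fun j => eval (complexify t) (g j - g' j)) (fun s => ?_) j
  have := (h (s • t)).sub (h' (s • t))
  rw [sub_self] at this
  refine this.congr_fun fun i => ?_
  rw [← eval_complexify_smul ((hg i).sub (hg' i)), map_sub]

variable {κ : Type*} [Fintype κ] (v : κ → E n)

/-- The homogeneous term of degree `j` in the expansion of `∑ₖ cₖ exp (vₖ · t)`. -/
noncomputable def expTerm (j : ℕ) : (κ → ℂ) →ₗ[ℂ] Poly n :=
  Fintype.linearCombination ℂ fun k => ((j.factorial : ℂ)⁻¹) • linForm (v k) ^ j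

theorem expTerm_apply (j : ℕ) (c : κ → ℂ) :
    expTerm v j c = ∑ k, c k • ((j.factorial : ℂ)⁻¹) • linForm (v k) ^ j :=
  Fintype.linearCombination_apply _ _ _

theorem isHomogeneous_expTerm (j : ℕ) (c : κ → ℂ) : (expTerm v j c).IsHomogeneous j := by
  rw [expTerm_apply]
  refine IsHomogeneous.sum _ _ _ fun k _ => ?_
  rw [smul_eq_C_mul, smul_eq_C_mul]
  have := (isHomogeneous_linForm (v k)).pow j
  rw [one_mul] at this
  exact (this.C_mul _).C_mul _

theorem hasSum_eval_expTerm (c : κ → ℂ) (t : E n) :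
    HasSum (fun j => eval (complexify t) (expTerm v j c)) ((∑ k, c k • expFun (v k)) t) := by
  simp only [expTerm_apply, map_sum, Finset.sum_apply, Pi.smul_apply]
  refine hasSum_sum fun k _ => ?_
  simp only [smul_eval, map_pow, eval_linForm, smul_eq_mul]
  refine HasSum.mul_left _ ?_
  have := NormedSpace.expSeries_div_hasSum_exp (((inner ℝ (v k) t : ℝ) : ℂ))
  rw [← Complex.exp_eq_exp_ℂ] at this
  simp only [div_eq_inv_mul] at this
  exact this

theorem expFun_injective : Function.Injective (expFun (n := n)) := by
  intro v w h
  refine ext_inner_right ℝ fun t => ?_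
  have := congrFun h t
  simp only [expFun, ← Complex.ofReal_exp, Complex.ofReal_inj, Real.exp_eq_exp] at this
  exact this

/-- Exponentials are distinct characters of the additive group, so Dedekind's theorem applies. -/
theorem linearIndependent_expFun : LinearIndependent ℂ (expFun (n := n)) := by
  let φ : E n → (Multiplicative (E n) →* ℂ) := fun v =>
    { toFun := fun t => expFun v t.toAdd
      map_one' := by simp [expFun]
      map_mul' := fun s t => by simp [expFun, inner_add_right, Complex.exp_add] }
  have hφ : Function.Injective φ := fun v w h => expFun_injective (by
    ext t
    exact DFunLike.congr_fun h (Multiplicative.ofAdd t))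
  exact (linearIndependent_monoidHom (Multiplicative (E n)) ℂ).comp φ hφ

/-- The coefficient vectors `c` for which the expansion of `∑ₖ cₖ exp (vₖ · t)` starts in degree
at least `j`. -/
noncomputable def expFil (j : ℕ) : Submodule ℂ (κ → ℂ) :=
  ⨅ i ∈ Set.Iio j, LinearMap.ker (expTerm v i)

theorem mem_expFil {j : ℕ} {c : κ → ℂ} : c ∈ expFil v j ↔ ∀ i < j, expTerm v i c = 0 := by
  simp [expFil]

theorem expFil_antitone : Antitone (expFil v) := fun _ _ h _ hc =>
  (mem_expFil v).2 fun i hi => (mem_expFil v).1 hc i (hi.trans_le h)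

variable {v} in
theorem eq_zero_of_forall_expTerm_eq_zero (hv : Function.Injective v) {c : κ → ℂ}
    (h : ∀ j, expTerm v j c = 0) : c = 0 := by
  have hf : ∑ k, c k • expFun (v k) = 0 := by
    ext t
    have := hasSum_eval_expTerm v c t
    simp only [h, map_zero] at this
    exact this.unique hasSum_zero
  exact funext (Fintype.linearIndependent_iff.1 (linearIndependent_expFun.comp v hv) c hf)

/-- The filtration stabilises in finite dimension, and a vector in all its steps has zero expansion.
-/
theorem exists_expFil_eq_bot (hv : Function.Injective v) : ∃ N, expFil v N = ⊥ := by
  obtain ⟨N, hN⟩ := IsArtinian.monotone_stabilizes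
    (⟨expFil v, expFil_antitone v⟩ : ℕ →o (Submodule ℂ (κ → ℂ))ᵒᵈ)
  refine ⟨N, (Submodule.eq_bot_iff _).2 fun c hc => eq_zero_of_forall_expTerm_eq_zero hv
    fun j => ?_⟩
  rcases le_total N (j + 1) with h | h
  · have : c ∈ expFil v (j + 1) := by
      have : expFil v N = expFil v (j + 1) := hN (j + 1) h
      rwa [← this]
    exact (mem_expFil v).1 this j j.lt_succ_self
  · exact (mem_expFil v).1 hc j h

theorem isLeastTerm_expTerm {j : ℕ} {c : κ → ℂ} (hc : c ∈ expFil v j) (h : expTerm v j c ≠ 0) :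
    IsLeastTerm (∑ k, c k • expFun (v k)) (expTerm v j c) :=
  ⟨fun i => expTerm v i c, j, fun i => isHomogeneous_expTerm v i c, hasSum_eval_expTerm v c,
    (mem_expFil v).1 hc, h, rfl⟩

theorem sum_smul_expFun_mem_expSpace (c : κ → ℂ) :
    ∑ k, c k • expFun (v k) ∈ expSpace (Set.range v) :=
  Submodule.sum_mem _ fun k _ => Submodule.smul_mem _ _
    (Submodule.subset_span ⟨v k, ⟨k, rfl⟩, rfl⟩)

theorem IsLeastTerm.exists_eq_expTerm {f : E n → ℂ} (hf : f ∈ expSpace (Set.range v)) {p : Poly n}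
    (hp : IsLeastTerm f p) : ∃ j, ∃ c ∈ expFil v j, p = expTerm v j c := by
  rw [expSpace, ← Set.range_comp, Submodule.mem_span_range_iff_exists_fun] at hf
  obtain ⟨c, rfl⟩ := hf
  obtain ⟨g, j, hg, hsum, h0, -, rfl⟩ := hp
  have : g = fun i => expTerm v i c := homogeneous_expansion_unique hg
    (fun i => isHomogeneous_expTerm v i c) hsum (hasSum_eval_expTerm v c)
  subst this
  exact ⟨j, c, (mem_expFil v).2 h0, rfl⟩

theorem map_expTerm_le_leastSpace (j : ℕ) :
    (expFil v j).map (expTerm v j) ≤ leastSpace (Set.range v) := by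
  rintro _ ⟨c, hc, rfl⟩
  by_cases h : expTerm v j c = 0
  · rw [h]; exact zero_mem _
  refine Submodule.subset_span ⟨_, sum_smul_expFun_mem_expSpace v c, fun h0 => h ?_,
    isLeastTerm_expTerm v hc h⟩
  have := homogeneous_expansion_unique (g' := 0) (fun i => isHomogeneous_expTerm v i c)
    (fun i => isHomogeneous_zero _ _ i) (hasSum_eval_expTerm v c) (fun t => by rw [h0]; simp)
  exact congrFun this j

/-- Rank-nullity: the `j`-th graded piece of the filtration is the space of least terms of degree
`j`. -/
theorem finrank_expFil (j : ℕ) : Module.finrank ℂ (expFil v j) =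
    Module.finrank ℂ ((expFil v j).map (expTerm v j)) + Module.finrank ℂ (expFil v (j + 1)) := by
  have h := LinearMap.finrank_range_add_finrank_ker ((expTerm v j).domRestrict (expFil v j))
  rw [LinearMap.range_domRestrict] at h
  have hle := expFil_antitone v j.le_succ
  have hker : LinearMap.ker ((expTerm v j).domRestrict (expFil v j)) =
      (expFil v (j + 1)).submoduleOf (expFil v j) := by
    ext c
    rw [LinearMap.mem_ker, LinearMap.domRestrict_apply, Submodule.submoduleOf, Submodule.mem_comap,
      Submodule.subtype_apply, mem_expFil]
    refine ⟨fun hc i hi => ?_, fun hc => hc j j.lt_succ_self⟩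
    rcases (Nat.lt_succ_iff_lt_or_eq.1 hi) with h | rfl
    · exact (mem_expFil v).1 c.2 i h
    · exact hc
  rw [hker, (Submodule.submoduleOfEquivOfLe hle).finrank_eq] at h
  exact h.symm

theorem finrank_expFil_le (N : ℕ) (hN : expFil v N = ⊥) (d : ℕ) : ∀ j, j + d = N →
    Module.finrank ℂ (expFil v j) ≤
      Module.finrank ℂ ((Finset.Ico j N).sup fun i => (expFil v i).map (expTerm v i) :
        Submodule ℂ (Poly n)) := by
  induction d with
  | zero => 
    rintro j rfl
    rw [add_zero] at hN
    rw [hN, finrank_bot]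
    exact Nat.zero_le _
  | succ d ih =>
    intro j hj
    have hlt : j < N := by omega
    rw [finrank_expFil, ← Finset.insert_Ico_add_one_left_eq_Ico hlt, Finset.sup_insert]
    refine (Nat.add_le_add_left (ih (j + 1) (by omega)) _).trans ?_
    -- Least terms of different degrees are independent, so the dimensions of the graded pieces add
    -- up.
    have hinf : ((expFil v j).map (expTerm v j)) ⊓
        ((Finset.Ico (j + 1) N).sup fun i => (expFil v i).map (expTerm v i)) = ⊥ := by
      refine (Submodule.eq_bot_iff _).2 fun p hp => ?_
      have hker : ((Finset.Ico (j + 1) N).sup fun i => (expFil v i).map (expTerm v i)) ≤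
          LinearMap.ker (homogeneousComponent (σ := Fin n) (R := ℂ) j) := by
        refine Finset.sup_le fun i hi => ?_
        rintro _ ⟨c, -, rfl⟩
        rw [LinearMap.mem_ker, homogeneousComponent_of_mem (isHomogeneous_expTerm v i c), if_neg]
        have := (Finset.mem_Ico.1 hi).1
        omega
      obtain ⟨⟨c, -, rfl⟩, h⟩ := hp
      have := hker h
      rwa [LinearMap.mem_ker, homogeneousComponent_of_mem (isHomogeneous_expTerm v j c),
        if_pos rfl] at this
    rw [← Submodule.finrank_sup_add_finrank_inf_eq, hinf, finrank_bot, add_zero]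

theorem card_le_finrank_of_leastSpace_le (hv : Function.Injective v) (D : Submodule ℂ (Poly n))
    [Module.Finite ℂ D] (h : leastSpace (Set.range v) ≤ D) :
    Fintype.card κ ≤ Module.finrank ℂ D := by
  obtain ⟨N, hN⟩ := exists_expFil_eq_bot v hv
  have h0 : expFil v 0 = ⊤ := by
    refine eq_top_iff.2 fun c _ => (mem_expFil v).2 fun i hi => absurd hi (Nat.not_lt_zero i)
  have := finrank_expFil_le v N hN N 0 (zero_add N)
  rw [h0, finrank_top, Module.finrank_fintype_fun_eq_card] at this
  refine this.trans (Submodule.finrank_mono (le_trans (Finset.sup_le fun i _ => ?_) h))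
  exact map_expTerm_le_leastSpace v i

theorem diffOp_linForm_linForm_pow (y x : E n) (j : ℕ) :
    diffOp (linForm y) (linForm x ^ (j + 1)) =
      (((j + 1 : ℕ) : ℂ) * ((inner ℝ y x : ℝ) : ℂ)) • linForm x ^ j := by
  induction j with
  | zero => simp [diffOp_linForm_linForm, smul_eq_C_mul]
  | succ j ih =>
    rw [pow_succ, diffOp_linForm_mul, ih, diffOp_linForm_linForm]
    simp only [smul_eq_C_mul]
    push_cast
    simp only [C_mul, C_add, C_1]
    ring

theorem diffOp_linForm_expTerm_zero (y : E n) (c : κ → ℂ) :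
    diffOp (linForm y) (expTerm v 0 c) = 0 := by
  have : diffOp (linForm y) (1 : Poly n) = 0 := by
    simpa using diffOp_linForm_C y 1
  simp [expTerm_apply, this]

theorem diffOp_linForm_expTerm_succ (y : E n) (j : ℕ) (c : κ → ℂ) :
    diffOp (linForm y) (expTerm v (j + 1) c) =
      expTerm v j fun k => ((inner ℝ y (v k) : ℝ) : ℂ) * c k := by
  simp only [expTerm_apply, map_sum, map_smul, diffOp_linForm_linForm_pow, smul_smul]
  refine Finset.sum_congr rfl fun k _ => ?_
  congr 1
  rw [Nat.factorial_succ]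
  have h1 : ((j + 1 : ℕ) : ℂ) ≠ 0 := by exact_mod_cast j.succ_ne_zero
  have h2 : (j.factorial : ℂ) ≠ 0 := by exact_mod_cast j.factorial_ne_zero
  rw [Nat.cast_mul]
  field_simp

/-- The operator `D_x - b` multiplies the coefficient of `exp (v · t)` by `x · v - b`. On a sum
whose expansion starts in degree `j + 1`, the term of degree `j` of the result is just `D_x` of the
leading one, since `b` multiplies a zero term. Iteration over `Y` leads to a zero sum. -/
theorem diffOp_prodForm_expTerm {κ' : Type*} (x : κ' → E n) (b : κ' → ℝ) (Y : Finset κ') :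
    ∀ (j : ℕ) (c : κ → ℂ), c ∈ expFil v j →
      (∀ k, (∏ y ∈ Y, (((inner ℝ (x y) (v k) - b y : ℝ)) : ℂ)) * c k = 0) →
      diffOp (prodForm x Y) (expTerm v j c) = 0 := by
  classical
  induction Y using Finset.induction_on with
  | empty =>
    intro j c _ h
    have : c = 0 := funext fun k => by simpa using h k
    simp [this]
  | insert a Y ha ih =>
    intro j c hc h
    rw [prodForm_insert x ha, mul_comm, diffOp_mul_apply]
    have hshift : ∀ i, diffOp (linForm (x a)) (expTerm v (i + 1) c) =
        expTerm v i (fun k => ((inner ℝ (x a) (v k) - b a : ℝ) : ℂ) * c k) +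
          (b a : ℂ) • expTerm v i c := fun i => by
      rw [diffOp_linForm_expTerm_succ, ← map_smul, ← map_add]
      congr 1
      ext k
      simp
      ring
    cases j with
    | zero => rw [diffOp_linForm_expTerm_zero, map_zero]
    | succ j =>
      rw [hshift, (mem_expFil v).1 hc j j.lt_succ_self, smul_zero, add_zero]
      refine ih j _ ((mem_expFil v).2 fun i hi => ?_) fun k => ?_
      · have := hshift i
        rw [(mem_expFil v).1 hc (i + 1) (by omega), (mem_expFil v).1 hc i (by omega)] at this
        simpa using this.symm
      · rw [← h k, Finset.prod_insert ha]; ring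

end LeastSpace

/-! ### Simple arrangements and their vertices -/

section Simple

variable {n : ℕ} {κ : Type*}

/-- The values of the linear forms `x b`, `b ∈ s`. -/
noncomputable def innerMap (x : κ → E n) (s : Finset κ) : E n →ₗ[ℝ] (s → ℝ) :=
  LinearMap.pi fun b => innerₛₗ ℝ (x b)

theorem mem_flat {x : κ → E n} {c : κ → ℝ} {s : Finset κ} {t : E n} :
    t ∈ flat x c s ↔ ∀ b ∈ s, inner ℝ (x b) t = c b := by
  simp [flat, hyperplane]

theorem mem_flat_iff_innerMap {x : κ → E n} {c : κ → ℝ} {s : Finset κ} {t : E n} :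
    t ∈ flat x c s ↔ innerMap x s t = fun b : s => c b := by
  rw [mem_flat, funext_iff]
  exact ⟨fun h b => h b b.2, fun h b hb => h ⟨b, hb⟩⟩

theorem finrank_vectorSpan_flat {x : κ → E n} {s : Finset κ}
    (hs : Function.Surjective (innerMap x s)) (c : κ → ℝ) :
    Module.finrank ℝ (vectorSpan ℝ (flat x c s)) + s.card = n := by
  obtain ⟨t₀, ht₀⟩ := hs fun b : s => c b
  have hflat : flat x c s = (AffineSubspace.mk' t₀ (LinearMap.ker (innerMap x s)) : Set (E n)) := by
    ext t
    rw [mem_flat_iff_innerMap, SetLike.mem_coe, AffineSubspace.mem_mk', LinearMap.mem_ker,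
      vsub_eq_sub, map_sub, ht₀, sub_eq_zero]
  have hspan : vectorSpan ℝ (flat x c s) = LinearMap.ker (innerMap x s) := by
    rw [hflat]
    exact AffineSubspace.direction_mk' t₀ _
  have h := LinearMap.finrank_range_add_finrank_ker (innerMap x s)
  rw [LinearMap.range_eq_top.2 hs, finrank_top, finrank_euclideanSpace_fin] at h
  rw [hspan]
  simpa [add_comm] using h

/-- For dependent normals, the right-hand sides with a non-empty intersection form a proper
subspace; a vector outside these finitely many subspaces is simple. -/
theorem exists_isSimpleArrangement [Finite κ] (x : κ → E n) :
    ∃ c : κ → ℝ, IsSimpleArrangement x c := by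
  classical
  have := Fintype.ofFinite κ
  let bad : Finset κ → Submodule ℝ (κ → ℝ) := fun s =>
    (LinearMap.range (innerMap x s)).comap (LinearMap.funLeft ℝ ℝ ((↑) : s → κ))
  let S : Finset (Submodule ℝ (κ → ℝ)) :=
    (Finset.univ.filter fun s => ¬ Function.Surjective (innerMap x s)).image bad
  have hS : ⊤ ∉ S := by
    intro h
    obtain ⟨s, hs, htop⟩ := Finset.mem_image.1 h
    refine (Finset.mem_filter.1 hs).2 fun d => ?_
    obtain ⟨c, hc⟩ := LinearMap.funLeft_surjective_of_injective ℝ ℝ ((↑) : s → κ)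
      Subtype.val_injective d
    have : c ∈ bad s := htop ▸ Submodule.mem_top
    rw [← hc]
    exact this
  have hne := Subspace.biUnion_ne_univ_of_top_notMem hS
  obtain ⟨c, hc⟩ := (Set.ne_univ_iff_exists_notMem _).1 hne
  refine ⟨c, fun s => ?_⟩
  by_cases hs : Function.Surjective (innerMap x s)
  · exact Or.inr (finrank_vectorSpan_flat hs c)
  · refine Or.inl (Set.eq_empty_iff_forall_notMem.2 fun t ht => hc ?_)
    refine Set.mem_biUnion (Finset.mem_coe.2 (Finset.mem_image.2
      ⟨s, Finset.mem_filter.2 ⟨Finset.mem_univ s, hs⟩, rfl⟩)) ?_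
    exact ⟨t, mem_flat_iff_innerMap.1 ht⟩

theorem exists_flat_eq_singleton {x : κ → E n} {s : Finset κ} (hspan : spanOf x (s : Set κ) = ⊤)
    (hcard : s.card = n) (c : κ → ℝ) : ∃ v, flat x c s = {v} := by
  have hinj : Function.Injective (innerMap x s) := by
    rw [injective_iff_map_eq_zero]
    intro t ht
    have hle : spanOf x (s : Set κ) ≤ (Submodule.span ℝ {t})ᗮ := by
      rw [spanOf_le]
      intro b hb
      rw [Submodule.mem_orthogonal_singleton_iff_inner_left]
      exact congrFun ht ⟨b, hb⟩
    rw [hspan] at hle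
    have := Submodule.mem_orthogonal_singleton_iff_inner_left.1 (hle (Submodule.mem_top (x := t)))
    exact inner_self_eq_zero.1 this
  have hsurj : Function.Surjective (innerMap x s) :=
    (LinearMap.injective_iff_surjective_of_finrank_eq_finrank (by simp [hcard])).1 hinj
  obtain ⟨v, hv⟩ := hsurj fun b : s => c b
  refine ⟨v, Set.eq_singleton_iff_unique_mem.2 ⟨mem_flat_iff_innerMap.2 hv, fun t ht => hinj ?_⟩⟩
  rw [hv, mem_flat_iff_innerMap.1 ht]

theorem IsSimpleArrangement.card_eq {x : κ → E n} {c : κ → ℝ} (h : IsSimpleArrangement x c)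
    {s : Finset κ} {v : E n} (hs : flat x c s = {v}) : s.card = n := by
  have := (h s).resolve_left (by simp [hs])
  rw [hs, vectorSpan_singleton, finrank_bot, zero_add] at this
  exact this

/-- All hyperplanes of `s ∪ s'` pass through `v`, so simplicity forces all three sets to have `n`
elements. -/
theorem IsSimpleArrangement.eq_of_flat_eq {x : κ → E n} {c : κ → ℝ} (h : IsSimpleArrangement x c)
    {s s' : Finset κ} {v : E n} (hs : flat x c s = {v}) (hs' : flat x c s' = {v}) : s = s' := by
  classical
  have hu : flat x c (s ∪ s') = {v} := by
    ext t
    have h1 : t ∈ flat x c (s ∪ s') ↔ t ∈ flat x c s ∧ t ∈ flat x c s' := by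
      simp only [mem_flat, Finset.mem_union, or_imp, forall_and]
    rw [h1, hs, hs', and_self]
  have h1 := Finset.eq_of_subset_of_card_le (Finset.subset_union_left (s₁ := s) (s₂ := s'))
    (by rw [h.card_eq hu, h.card_eq hs])
  have h2 := Finset.eq_of_subset_of_card_le (Finset.subset_union_right (s₁ := s) (s₂ := s'))
    (by rw [h.card_eq hu, h.card_eq hs'])
  rw [h1, ← h2]

end Simple

/-! ### The bounds `#𝕀' ≤ dim Π(V(𝕀'))` and `Π(V(𝕀')) ≤ 𝒟₊` -/

section Vertices

variable {n : ℕ} {ι : Type*} {X : ι → E n} {II : Set (Finset ι)}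
  {B₀ : Module.Basis (Fin n) ℝ (E n)}

theorem exists_vertex_map (hII : II ⊆ indepSets X) {c : ι ⊕ Fin n → ℝ}
    (hc : IsSimpleArrangement (augment X B₀) c) :
    ∃ v : II → E n, Function.Injective v ∧ Set.range v = vertices X B₀ c II ∧
      ∀ I : II, flat (augment X B₀) c (ex X B₀ I) = {v I} := by
  choose v hv using fun I : II =>
    exists_flat_eq_singleton (spanOf_augment_ex B₀ I) (card_ex B₀ (hII I.2)) c
  refine ⟨v, fun I I' h => ?_, ?_, hv⟩
  · refine Subtype.ext (ex_injective B₀ (X := X) (hc.eq_of_flat_eq (hv I) ?_))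
    rw [h, hv I']
  · ext w
    constructor
    · rintro ⟨I, rfl⟩
      exact ⟨I, I.2, hv I⟩
    · rintro ⟨I, hI, h⟩
      exact ⟨⟨I, hI⟩, Set.singleton_injective ((hv ⟨I, hI⟩).symm.trans h)⟩

theorem leastSpace_vertices_le_spaceD [Finite ι] (hII : II ⊆ indepSets X) {c : ι ⊕ Fin n → ℝ}
    (hc : IsSimpleArrangement (augment X B₀) c) :
    leastSpace (vertices X B₀ c II) ≤ spaceD X B₀ II := by
  have := Fintype.ofFinite II
  obtain ⟨v, -, hrange, hv⟩ := exists_vertex_map hII hc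
  rw [← hrange]
  refine Submodule.span_le.2 ?_
  rintro _ ⟨f, hf, -, hp⟩
  obtain ⟨j, a, ha, rfl⟩ := hp.exists_eq_expTerm v hf
  refine mem_idealKer_span.2 ?_
  rintro _ ⟨Y, hY, rfl⟩
  refine diffOp_prodForm_expTerm v _ c Y j a ha fun I => ?_
  obtain ⟨b, hbY, hb⟩ := Finset.not_disjoint_iff.1 (hY I I.2)
  have hmem : v I ∈ flat (augment X B₀) c (ex X B₀ I) := by rw [hv]; rfl
  rw [Finset.prod_eq_zero hbY, zero_mul]
  rw [mem_flat.1 hmem b hb, sub_self, Complex.ofReal_zero]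

theorem ncard_le_finrank_of_leastSpace_vertices_le [Finite ι] (hII : II ⊆ indepSets X)
    {c : ι ⊕ Fin n → ℝ} (hc : IsSimpleArrangement (augment X B₀) c) (D : Submodule ℂ (Poly n))
    [Module.Finite ℂ D] (hD : leastSpace (vertices X B₀ c II) ≤ D) :
    II.ncard ≤ Module.finrank ℂ D := by
  have := Fintype.ofFinite II
  obtain ⟨v, hinj, hrange, -⟩ := exists_vertex_map hII hc
  rw [← Nat.card_coe_set_eq, Nat.card_eq_fintype_card]
  exact card_le_finrank_of_leastSpace_le v hinj D (hrange ▸ hD)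

end Vertices

/-! ### Polynomials modulo linear forms, and cancellation of a linear factor -/

section LinIdeal

variable {n : ℕ}

/-- The ideal generated by the linear forms `p_a`, `a ∈ K`. -/
noncomputable def linIdeal (K : Submodule ℝ (E n)) : Ideal (Poly n) :=
  Ideal.span (linForm '' (K : Set (E n)))

theorem linForm_mem_linIdeal {K : Submodule ℝ (E n)} {a : E n} (ha : a ∈ K) :
    linForm a ∈ linIdeal K :=
  Ideal.subset_span ⟨a, ha, rfl⟩

theorem linIdeal_mono {K L : Submodule ℝ (E n)} (h : K ≤ L) : linIdeal K ≤ linIdeal L :=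
  Ideal.span_mono (Set.image_mono h)

theorem smul_mem_ideal {J : Ideal (Poly n)} (c : ℂ) {f : Poly n} (hf : f ∈ J) : c • f ∈ J := by
  rw [smul_eq_C_mul]
  exact J.mul_mem_left _ hf

theorem mem_ideal_of_smul_mem {J : Ideal (Poly n)} {c : ℂ} (hc : c ≠ 0) {f : Poly n}
    (hf : c • f ∈ J) : f ∈ J := by
  simpa [smul_smul, inv_mul_cancel₀ hc] using smul_mem_ideal c⁻¹ hf

theorem linIdeal_bot : linIdeal (⊥ : Submodule ℝ (E n)) = ⊥ := by
  simp [linIdeal, linForm_zero]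

theorem linIdeal_sup_span_singleton_le (K : Submodule ℝ (E n)) (x : E n) :
    linIdeal (K ⊔ ℝ ∙ x) ≤ linIdeal K ⊔ Ideal.span {linForm x} := by
  refine Ideal.span_le.2 ?_
  rintro _ ⟨a, ha, rfl⟩
  obtain ⟨k, hk, y, hy, rfl⟩ := Submodule.mem_sup.1 ha
  obtain ⟨c, rfl⟩ := Submodule.mem_span_singleton.1 hy
  rw [linForm_add, linForm_smul]
  exact add_mem (Ideal.mem_sup_left (linForm_mem_linIdeal hk))
    (Ideal.mem_sup_right (smul_mem_ideal _ (Ideal.mem_span_singleton_self _)))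

/-- Substituting the orthogonal projection of `t` to `Kᗮ` does not change `f` modulo the ideal, and
it gives zero if `f` vanishes on `Kᗮ`. Real points suffice, since a polynomial vanishing on them is
zero. -/
theorem mem_linIdeal_iff {K : Submodule ℝ (E n)} {f : Poly n} :
    f ∈ linIdeal K ↔ ∀ t ∈ Kᗮ, eval (complexify t) f = 0 := by
  constructor
  · intro hf t ht
    have : linIdeal K ≤ RingHom.ker (eval (complexify t)) := by
      refine Ideal.span_le.2 ?_
      rintro _ ⟨a, ha, rfl⟩
      rw [SetLike.mem_coe, RingHom.mem_ker, eval_linForm, (K.mem_orthogonal t).1 ht a ha,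
        Complex.ofReal_zero]
    exact this hf
  · intro h
    let w : Fin n → E n := fun i => Kᗮ.starProjection (EuclideanSpace.single i 1)
    have hw : ∀ i, EuclideanSpace.single i 1 - w i ∈ K := fun i => by
      have := Kᗮ.sub_starProjection_mem_orthogonal (EuclideanSpace.single i (1 : ℝ))
      rwa [K.orthogonal_orthogonal] at this
    have heval : ∀ (z : Fin n → ℂ) (f : Poly n), eval z (aeval (fun i => linForm (w i)) f) =
        eval (fun i => eval z (linForm (w i))) f := fun z f => by
      induction f using MvPolynomial.induction_on with
      | C a => simp
      | add p q hp hq => rw [map_add, map_add, hp, hq, map_add]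
      | mul_X p i hp => rw [map_mul, map_mul, hp, map_mul, aeval_X, eval_X]
    have hφ : aeval (fun i => linForm (w i)) f = (0 : Poly n) := by
      refine eq_zero_of_forall_eval_complexify fun t => ?_
      have hpt : (fun i => eval (complexify t) (linForm (w i))) =
          complexify (Kᗮ.starProjection t) := by
        ext i
        rw [eval_linForm, complexify, Submodule.inner_starProjection_left_eq_right,
          EuclideanSpace.inner_single_left]
        simp
      rw [← h _ (Submodule.starProjection_apply_mem Kᗮ t), ← hpt, heval]
    have hmk : (Ideal.Quotient.mkₐ ℂ (linIdeal K)) =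
        (Ideal.Quotient.mkₐ ℂ (linIdeal K)).comp (aeval fun i => linForm (w i)) := by
      refine MvPolynomial.algHom_ext fun i => ?_
      rw [AlgHom.comp_apply, aeval_X, Ideal.Quotient.mkₐ_eq_mk, Ideal.Quotient.eq, ← linForm_single]
      have := linForm_mem_linIdeal (hw i)
      rwa [show linForm (EuclideanSpace.single i 1 - w i) =
        linForm (EuclideanSpace.single i 1) - linForm (w i) from map_sub linFormₗ _ _] at this
    have := DFunLike.congr_fun hmk f
    rw [AlgHom.comp_apply, hφ, map_zero, Ideal.Quotient.mkₐ_eq_mk, Ideal.Quotient.eq_zero_iff_mem]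
      at this
    exact this

theorem hasDerivAt_eval_line (t ξ : E n) (f : Poly n) (s : ℝ) :
    HasDerivAt (fun s : ℝ => eval (complexify (t + s • ξ)) f)
      (eval (complexify (t + s • ξ)) (diffOp (linForm ξ) f)) s := by
  induction f using MvPolynomial.induction_on with
  | C a => simpa [diffOp_linForm_C] using hasDerivAt_const s a
  | add p q hp hq => simp only [map_add]; exact hp.add hq
  | mul_X p i hp =>
    rw [← linForm_single, diffOp_linForm_mul, diffOp_linForm_linForm]
    simp only [map_mul, map_add, eval_C]
    refine hp.mul ?_
    simp only [eval_linForm]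
    refine HasDerivAt.ofReal_comp ?_
    simp only [inner_add_right, inner_smul_right]
    rw [real_inner_comm (EuclideanSpace.single i 1) ξ]
    simpa using ((hasDerivAt_id s).mul_const (inner ℝ (EuclideanSpace.single i 1) ξ)).const_add
      (inner ℝ (EuclideanSpace.single i 1) t)

theorem sub_C_mem_linIdeal {K : Submodule ℝ (E n)} {f : Poly n}
    (h : ∀ ξ ∈ Kᗮ, diffOp (linForm ξ) f ∈ linIdeal K) :
    f - C (eval (complexify 0) f) ∈ linIdeal K := by
  refine mem_linIdeal_iff.2 fun t ht => ?_
  have hd := hasDerivAt_eval_line 0 t f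
  have h0 : ∀ s : ℝ, deriv (fun s : ℝ => eval (complexify (0 + s • t)) f) s = 0 := fun s => by
    rw [(hd s).deriv]
    exact mem_linIdeal_iff.1 (h t ht) _ (by rw [zero_add]; exact Submodule.smul_mem _ s ht)
  have := is_const_of_deriv_eq_zero (fun s => (hd s).differentiableAt) h0 1 0
  simp only [zero_add, one_smul, zero_smul] at this
  simp [this]

theorem exists_mem_orthogonal_inner_ne_zero {S : Submodule ℝ (E n)} {x : E n} (hx : x ∉ S) :
    ∃ w ∈ Sᗮ, inner ℝ x w ≠ 0 := by
  by_contra! hcon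
  refine hx ?_
  rw [← S.orthogonal_orthogonal, Submodule.mem_orthogonal']
  exact hcon

/-- On `Kᗮ`, `g` vanishes off the hyperplane `x · t = 0`, which is proper there, and hence
everywhere by continuity. -/
theorem mem_linIdeal_of_linForm_mul_mem {K : Submodule ℝ (E n)} {x : E n} (hx : x ∉ K)
    {g : Poly n} (h : linForm x * g ∈ linIdeal K) : g ∈ linIdeal K := by
  obtain ⟨w, hw, hxw⟩ := exists_mem_orthogonal_inner_ne_zero hx
  have key : ∀ t ∈ Kᗮ, inner ℝ x t ≠ 0 → eval (complexify t) g = 0 := fun t ht hxt => by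
    have := mem_linIdeal_iff.1 h t ht
    rw [map_mul, eval_linForm] at this
    exact (mul_eq_zero.1 this).resolve_left (by exact_mod_cast hxt)
  refine mem_linIdeal_iff.2 fun t ht => ?_
  by_cases hxt : inner ℝ x t = 0
  · have hcont := (hasDerivAt_eval_line t w g 0).continuousAt
    have hlim : Filter.Tendsto (fun s : ℝ => eval (complexify (t + s • w)) g)
        (nhdsWithin 0 {0}ᶜ) (nhds 0) := by
      refine tendsto_const_nhds.congr' ?_
      filter_upwards [self_mem_nhdsWithin] with s hs
      refine (key _ (add_mem ht (Submodule.smul_mem _ s hw)) ?_).symm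
      rw [inner_add_right, hxt, inner_smul_right, zero_add]
      exact mul_ne_zero hs hxw
    have := tendsto_nhds_unique (hcont.tendsto.mono_left nhdsWithin_le_nhds) hlim
    simpa using this
  · exact key t ht hxt

theorem diffOp_mem_linIdeal {K : Submodule ℝ (E n)} {q : Poly n}
    (hq : ∀ a ∈ K, diffOp (linForm a) q = 0) {f : Poly n} (hf : f ∈ linIdeal K) :
    diffOp q f ∈ linIdeal K := by
  suffices h : ∀ r, diffOp q (r * f) ∈ linIdeal K by simpa using h 1
  refine Submodule.span_induction (p := fun f _ => ∀ r, diffOp q (r * f) ∈ linIdeal K)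
    ?_ ?_ ?_ ?_ hf
  · rintro _ ⟨a, ha, rfl⟩ r
    rw [mul_comm, diffOp_linForm_mul_apply, hq a ha, map_zero, LinearMap.zero_apply, add_zero]
    exact Ideal.mul_mem_right _ _ (linForm_mem_linIdeal ha)
  · intro r; simp
  · intro x y _ _ hx hy r
    rw [mul_add, map_add]
    exact add_mem (hx r) (hy r)
  · intro a x _ hx r
    rw [smul_eq_mul, ← mul_assoc]
    exact hx _

theorem diffOp_linForm_pow_eq_zero {a η : E n} (h : inner ℝ a η = 0) (k : ℕ) :
    diffOp (linForm a) (linForm η ^ k) = 0 := by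
  cases k with
  | zero => simpa using diffOp_linForm_C a 1
  | succ k => rw [diffOp_linForm_linForm_pow, h]; simp

theorem diffOp_linForm_pow_mem_linIdeal {K : Submodule ℝ (E n)} {η : E n} (hη : η ∈ Kᗮ) (k : ℕ)
    {f : Poly n} (hf : f ∈ linIdeal K) : diffOp (linForm η ^ k) f ∈ linIdeal K :=
  diffOp_mem_linIdeal (fun a ha => diffOp_linForm_pow_eq_zero ((K.mem_orthogonal η).1 hη a ha) k) hf

theorem diffOp_linForm_pow_mem_linIdeal_of_le {K : Submodule ℝ (E n)} {η : E n} (hη : η ∈ Kᗮ)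
    {k l : ℕ} (hkl : k ≤ l) {f : Poly n} (hf : diffOp (linForm η ^ k) f ∈ linIdeal K) :
    diffOp (linForm η ^ l) f ∈ linIdeal K := by
  rw [← Nat.sub_add_cancel hkl, pow_add, diffOp_mul_apply]
  exact diffOp_linForm_pow_mem_linIdeal hη _ hf

theorem mul_mem_homogPerp {S : Submodule ℝ (E n)} {p q : Poly n} {i j : ℕ}
    (hp : p ∈ homogPerp S i) (hq : q ∈ homogPerp S j) : p * q ∈ homogPerp S (i + j) :=
  ⟨hp.1.mul hq.1, fun η hη => by rw [diffOp_linForm_mul, hp.2 η hη, hq.2 η hη]; simp⟩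

theorem linForm_pow_mem_homogPerp {S : Submodule ℝ (E n)} {η : E n} (hη : η ∈ Sᗮ) (j : ℕ) :
    linForm η ^ j ∈ homogPerp S j := by
  refine ⟨?_, fun a ha => diffOp_linForm_pow_eq_zero ((S.mem_orthogonal η).1 hη a ha) j⟩
  have := (isHomogeneous_linForm η).pow j
  rwa [one_mul] at this

theorem diffOp_linForm_mem_homogPerp {S : Submodule ℝ (E n)} {p : Poly n} {j : ℕ}
    (hp : p ∈ homogPerp S (j + 1)) (x : E n) : diffOp (linForm x) p ∈ homogPerp S j := by
  refine ⟨?_, fun η hη => by rw [diffOp_comm, hp.2 η hη, map_zero]⟩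
  rw [diffOp_linForm]
  exact IsHomogeneous.sum _ _ _ fun i _ => (hp.1.pderiv (i := i)).C_mul _

/-- The commutator formula `D_η^(k+1) (p_x g) = p_x D_η^(k+1) g + (k+1) (x · η) D_η^k g` allows
descending induction on `k`, starting beyond the degree of `g`. -/
theorem diffOp_linForm_pow_mem_of_succ {K : Submodule ℝ (E n)} {η x : E n} (hη : η ∈ Kᗮ)
    (hx : inner ℝ x η ≠ 0) {m : ℕ} {g : Poly n}
    (h : diffOp (linForm η ^ (m + 1)) (linForm x * g) ∈ linIdeal K) :
    diffOp (linForm η ^ m) g ∈ linIdeal K := by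
  have key : ∀ d k, m ≤ k → k + d = m + g.totalDegree + 1 →
      diffOp (linForm η ^ k) g ∈ linIdeal K := by
    intro d
    induction d with
    | zero =>
      intro k _ hk
      rw [diffOp_eq_zero_of_totalDegree_lt (m := k) (linForm_pow_mem_homogPerp (S := ⊥)
        (by simp) k).1 (by omega)]
      exact zero_mem _
    | succ d ih =>
      intro k hmk hk
      have h1 := diffOp_linForm_pow_mem_linIdeal_of_le hη (Nat.succ_le_succ hmk) h
      rw [Nat.succ_eq_add_one, diffOp_linForm_mul_apply, diffOp_linForm_linForm_pow, map_smul,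
        LinearMap.smul_apply] at h1
      have h2 := (Ideal.add_mem_iff_right _ (Ideal.mul_mem_left _ _
        (ih (k + 1) (by omega) (by omega)))).1 h1
      exact mem_ideal_of_smul_mem (mul_ne_zero (by exact_mod_cast k.succ_ne_zero)
        (by exact_mod_cast hx)) h2
  exact key (g.totalDegree + 1) m le_rfl (by omega)

/-- The commutator of `q = p_η^(j+1) r` with `p_x` is `(j+1) (x · η) p_η^j r + p_η^(j+1) D_x r`. The
statement is proved for all `p_η^j r` of degree at least `m`, by ascending induction on `d = deg r`,
which handles `D_x r`, and descending induction on `j`, which handles `q(D) g`. -/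
theorem diffOp_mem_of_homogPerp_succ {K S : Submodule ℝ (E n)} (hKS : K ≤ S) {x : E n} (hx : x ∉ S)
    {m : ℕ} {g : Poly n}
    (h : ∀ q ∈ homogPerp S (m + 1), diffOp q (linForm x * g) ∈ linIdeal K) :
    ∀ r ∈ homogPerp S m, diffOp r g ∈ linIdeal K := by
  obtain ⟨η, hη, hxη⟩ := exists_mem_orthogonal_inner_ne_zero hx
  have hηK : η ∈ Kᗮ := Submodule.orthogonal_le hKS hη
  have step : ∀ d, d ≤ m → ∀ r ∈ homogPerp S d,
      (∀ j, m ≤ j + d → diffOp (linForm η ^ (j + 1) * diffOp (linForm x) r) g ∈ linIdeal K) →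
      ∀ e j, m ≤ j + d → j + e = m + g.totalDegree + 1 →
        diffOp (linForm η ^ j * r) g ∈ linIdeal K := by
    intro d hd r hr hD e
    induction e with
    | zero =>
      intro j _ hj
      rw [diffOp_eq_zero_of_totalDegree_lt (m := j + d)
        (mul_mem_homogPerp (linForm_pow_mem_homogPerp hη j) hr).1 (by omega)]
      exact zero_mem _
    | succ e ih =>
      intro j hmj hj
      have h1 : diffOp (linForm η ^ (j + 1) * r) (linForm x * g) ∈ linIdeal K := by
        have hsplit : linForm η ^ (j + 1) * r =
            linForm η ^ (j + d - m) * (linForm η ^ (m + 1 - d) * r) := by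
          rw [← mul_assoc, ← pow_add]
          congr 2
          omega
        rw [hsplit, diffOp_mul_apply]
        refine diffOp_linForm_pow_mem_linIdeal hηK _ (h _ ?_)
        have := mul_mem_homogPerp (linForm_pow_mem_homogPerp hη (m + 1 - d)) hr
        rwa [Nat.sub_add_cancel (by omega)] at this
      rw [diffOp_linForm_mul_apply, diffOp_linForm_mul, diffOp_linForm_linForm_pow, map_add,
        LinearMap.add_apply, smul_mul_assoc, map_smul, LinearMap.smul_apply] at h1
      have h2 := (Ideal.add_mem_iff_right _ (Ideal.mul_mem_left _ _
        (ih (j + 1) (by omega) (by omega)))).1 h1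
      have h3 := (Ideal.add_mem_iff_left _ (hD j hmj)).1 h2
      exact mem_ideal_of_smul_mem (mul_ne_zero (by exact_mod_cast j.succ_ne_zero)
        (by exact_mod_cast hxη)) h3
  have key : ∀ d, d ≤ m → ∀ r ∈ homogPerp S d, ∀ j, m ≤ j + d →
      diffOp (linForm η ^ j * r) g ∈ linIdeal K := by
    intro d
    induction d with
    | zero =>
      intro hd r hr j hj
      rcases le_total j (m + g.totalDegree + 1) with hle | hle
      · refine step 0 hd r hr (fun j _ => ?_) _ j hj (Nat.add_sub_of_le hle)
        obtain ⟨a, rfl⟩ : ∃ a, r = C a := ⟨_, totalDegree_eq_zero_iff_eq_C.1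
          (Nat.le_zero.1 hr.1.totalDegree_le)⟩
        rw [diffOp_linForm_C]
        simp
      · rw [diffOp_eq_zero_of_totalDegree_lt (m := j + 0)
          (mul_mem_homogPerp (linForm_pow_mem_homogPerp hη j) hr).1 (by omega)]
        exact zero_mem _
    | succ d ih =>
      intro hd r hr j hj
      rcases le_total j (m + g.totalDegree + 1) with hle | hle
      · exact step (d + 1) hd r hr (fun j hj => ih (by omega) _ (diffOp_linForm_mem_homogPerp hr x)
          (j + 1) (by omega)) _ j hj (Nat.add_sub_of_le hle)
      · rw [diffOp_eq_zero_of_totalDegree_lt (m := j + (d + 1))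
          (mul_mem_homogPerp (linForm_pow_mem_homogPerp hη j) hr).1 (by omega)]
        exact zero_mem _
  intro r hr
  simpa using key m le_rfl r hr 0 (by omega)

/-- All terms of `(D_η + D_ζ)^k g` other than `D_η^k g` contain `D_ζ g`. -/
theorem diffOp_linForm_add_pow_mem {K : Submodule ℝ (E n)} {η ζ : E n} (hη : η ∈ Kᗮ)
    (hζ : ζ ∈ Kᗮ) (k : ℕ) : ∀ g : Poly n, diffOp (linForm ζ) g ∈ linIdeal K →
      diffOp (linForm η ^ k) g ∈ linIdeal K → diffOp (linForm (η + ζ) ^ k) g ∈ linIdeal K := by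
  induction k with
  | zero => intro g _ h; simpa using h
  | succ k ih =>
    intro g hg h
    rw [diffOp_pow_succ_apply, linForm_add, map_add, LinearMap.add_apply, map_add, ← linForm_add]
    rw [diffOp_pow_succ_apply] at h
    refine add_mem (ih _ ?_ h) (diffOp_linForm_pow_mem_linIdeal (add_mem hη hζ) k hg)
    rw [diffOp_comm]
    simpa using diffOp_linForm_pow_mem_linIdeal hη 1 hg

end LinIdeal

/-! ### Deletion and contraction for the kernel conditions -/

section DeletionContraction

variable {n : ℕ} {ι : Type*} (X : ι → E n) (II : Set (Finset ι))

open Classical in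
/-- The vectors of the subfamily `T` outside the subspace `S`. -/
noncomputable def outside (T : Finset ι) (S : Submodule ℝ (E n)) : Finset ι :=
  T.filter fun i => X i ∉ S

variable {X} in
theorem mem_outside {T : Finset ι} {S : Submodule ℝ (E n)} {i : ι} :
    i ∈ outside X T S ↔ i ∈ T ∧ X i ∉ S := by
  simp [outside]

variable {X} in
theorem diffOp_prodForm_eq_zero {S : Submodule ℝ (E n)} {Y : Finset ι} {q : Poly n} {m : ℕ}
    (hq : q ∈ homogPerp S m) (hY : (outside X Y S).card < m) : diffOp q (prodForm X Y) = 0 := by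
  classical
  have hsplit : prodForm X Y = prodForm X (Y.filter fun i => X i ∈ S) *
      prodForm X (outside X Y S) := by
    rw [prodForm, prodForm, prodForm, outside, Finset.prod_filter_mul_prod_filter_not]
  rw [hsplit, diffOp_prodForm_mul_apply X fun y hy => hq.2 _ (Finset.mem_filter.1 hy).2,
    diffOp_eq_zero_of_totalDegree_lt hq.1, mul_zero]
  exact (isHomogeneous_prodForm X _).totalDegree_le.trans_lt hY

variable {X} in
theorem outside_mono {S S' : Submodule ℝ (E n)} {Y T : Finset ι} (hY : Y ⊆ T) (hS : S' ≤ S) :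
    outside X Y S ⊆ outside X T S' := fun i hi => by
  rw [mem_outside] at hi ⊢
  exact ⟨hY hi.1, fun h => hi.2 (hS h)⟩

variable [DecidableEq ι]

variable {X} in
theorem outside_insert_of_mem {T : Finset ι} {S : Submodule ℝ (E n)} {x : ι} (hx : X x ∈ S) :
    outside X (insert x T) S = outside X T S := by
  ext i
  rw [mem_outside, mem_outside, Finset.mem_insert]
  constructor
  · rintro ⟨rfl | h, hi⟩
    · exact absurd hx hi
    · exact ⟨h, hi⟩
  · exact fun h => ⟨Or.inr h.1, h.2⟩

variable {X} in
theorem card_outside_insert_of_notMem {T : Finset ι} {S : Submodule ℝ (E n)} {x : ι} (hxT : x ∉ T)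
    (hx : X x ∉ S) : (outside X (insert x T) S).card = (outside X T S).card + 1 := by
  rw [← Finset.card_insert_of_notMem (s := outside X T S) fun h => hxT (mem_outside.1 h).1]
  congr 1
  ext i
  simp only [mem_outside, Finset.mem_insert]
  constructor
  · rintro ⟨rfl | h, hi⟩
    · exact Or.inl rfl
    · exact Or.inr ⟨h, hi⟩
  · rintro (rfl | h)
    · exact ⟨Or.inl rfl, hx⟩
    · exact ⟨Or.inr h.1, h.2⟩

/-- The space spanned by the `p_Y`, `Y ⊆ T`, after deletion of the vectors outside `T ∪ A` and
contraction of the vectors in `A`. -/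
noncomputable def minorP (T A : Finset ι) : Submodule ℂ (Poly n) :=
  Submodule.span ℂ {p | ∃ Y ⊆ T, (∃ I ⊆ T, A ∪ I ∈ II ∧ Disjoint Y I) ∧ p = prodForm X Y}

/-- The differential conditions that describe `minorP X II T A`, modulo the linear forms that
vanish after the contraction of `A`. -/
structure MinorKer (T A : Finset ι) (f : Poly n) : Prop where
  facet : ∀ Y ⊆ T, Module.finrank ℝ (spanOf X ((A ∪ T : Finset ι) : Set ι)) ≤
      Module.finrank ℝ (spanOf X ((A ∪ Y : Finset ι) : Set ι)) + 1 →
    ∀ η ∈ (spanOf X ((A ∪ Y : Finset ι) : Set ι))ᗮ,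
      diffOp (linForm η ^ ((outside X T (spanOf X ((A ∪ Y : Finset ι) : Set ι))).card + 1)) f ∈
        linIdeal (spanOf X (A : Set ι))
  flat : ∀ I ⊆ T, A ∪ I ∈ indepSets X → A ∪ I ∉ II →
    ∀ q ∈ homogPerp (spanOf X ((A ∪ I : Finset ι) : Set ι))
        (outside X T (spanOf X ((A ∪ I : Finset ι) : Set ι))).card,
      diffOp q f ∈ linIdeal (spanOf X (A : Set ι))

variable {X II} {T A : Finset ι}

theorem spanOf_le_spanOf_union (A I : Finset ι) :
    spanOf X (A : Set ι) ≤ spanOf X ((A ∪ I : Finset ι) : Set ι) :=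
  spanOf_mono X (by simp)

theorem orthogonal_spanOf_union_le (A I : Finset ι) :
    (spanOf X ((A ∪ I : Finset ι) : Set ι))ᗮ ≤ (spanOf X (A : Set ι))ᗮ :=
  Submodule.orthogonal_le (spanOf_le_spanOf_union A I)

theorem spanOf_insert (x : ι) (s : Finset ι) :
    spanOf X ((insert x s : Finset ι) : Set ι) = spanOf X (s : Set ι) ⊔ ℝ ∙ X x := by
  rw [Finset.coe_insert, spanOf, Set.image_insert_eq, Submodule.span_insert, sup_comm, spanOf]

theorem MinorKer.sub {f g : Poly n} (hf : MinorKer X II T A f) (hg : MinorKer X II T A g) :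
    MinorKer X II T A (f - g) where
  facet Y hY h η hη := by
    rw [map_sub]; exact sub_mem (hf.facet Y hY h η hη) (hg.facet Y hY h η hη)
  flat I hI h h' q hq := by
    rw [map_sub]; exact sub_mem (hf.flat I hI h h' q hq) (hg.flat I hI h h' q hq)

theorem minorKer_of_mem_linIdeal {f : Poly n} (hf : f ∈ linIdeal (spanOf X (A : Set ι))) :
    MinorKer X II T A f where
  facet Y _ _ _ hη := diffOp_linForm_pow_mem_linIdeal (orthogonal_spanOf_union_le A Y hη) _ hf
  flat I _ _ _ _ hq := diffOp_mem_linIdeal (fun a ha => hq.2 a (spanOf_le_spanOf_union A I ha)) hf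

/-- Too few factors of `p_Y` lie outside the flat. If `Y` contained all of `T` outside `span (A ∪
I')`, a set `I` missing `Y` would lie in that span, and `A ∪ I'` would belong to the semi-external
family. -/
theorem minorKer_of_mem_minorP (hII : IsSemiExternal X II) {f : Poly n}
    (hf : f ∈ minorP X II T A) : MinorKer X II T A f := by
  have hprod : ∀ Y ⊆ T, ∀ I ⊆ T, A ∪ I ∈ II → Disjoint Y I → (∀ I' ⊆ T, A ∪ I' ∈ indepSets X →
      A ∪ I' ∉ II → (outside X Y (spanOf X ((A ∪ I' : Finset ι) : Set ι))).card <
        (outside X T (spanOf X ((A ∪ I' : Finset ι) : Set ι))).card) := by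
    intro Y hY I hI hAI hYI I' hI' hind hnot
    by_contra hcon
    have heq := Finset.eq_of_subset_of_card_le
      (outside_mono (X := X) hY (le_refl (spanOf X ((A ∪ I' : Finset ι) : Set ι)))) (not_lt.1 hcon)
    refine hnot (hII.2 _ hAI _ hind ((spanOf_le X).2 fun i hi => ?_))
    rcases Finset.mem_union.1 (Finset.mem_coe.1 hi) with h | h
    · exact mem_spanOf X (Finset.mem_coe.2 (Finset.mem_union_left _ h))
    · by_contra hcon
      have hi' := mem_outside.2 ⟨hI h, hcon⟩
      rw [← heq] at hi'
      exact Finset.disjoint_left.1 hYI (mem_outside.1 hi').1 h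
  have hzero : MinorKer X II T A 0 := minorKer_of_mem_linIdeal (zero_mem _)
  induction hf using Submodule.span_induction with
  | mem p hp =>
    obtain ⟨Y, hY, ⟨I, hI, hAI, hYI⟩, rfl⟩ := hp
    constructor
    · intro Z _ _ η hη
      rw [diffOp_prodForm_eq_zero (linForm_pow_mem_homogPerp hη _)]
      · exact zero_mem _
      · exact Nat.lt_succ_of_le (Finset.card_le_card (outside_mono hY le_rfl))
    · intro I' hI' hind hnot q hq
      rw [diffOp_prodForm_eq_zero hq (hprod Y hY I hI hAI hYI I' hI' hind hnot)]
      exact zero_mem _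
  | zero => exact hzero
  | add f g _ _ hf hg => simpa using hf.sub (hzero.sub hg)
  | smul c f _ hf =>
    constructor
    · intro Y hY h η hη
      rw [map_smul]; exact smul_mem_ideal c (hf.facet Y hY h η hη)
    · intro I hI h h' q hq
      rw [map_smul]; exact smul_mem_ideal c (hf.flat I hI h h' q hq)

theorem linForm_mul_mem_of_diffOp {x : E n} {q g : Poly n} (hq : diffOp (linForm x) q = 0) :
    diffOp q (linForm x * g) = linForm x * diffOp q g := by
  rw [diffOp_linForm_mul_apply, hq, map_zero, LinearMap.zero_apply, add_zero]

/-- Cancellation of a linear form that is constant in the direction `η`. -/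
theorem diffOp_pow_mem_of_linForm_mul {K : Submodule ℝ (E n)} {x η : E n} (hx : x ∉ K)
    (hxη : inner ℝ x η = 0) {k : ℕ} {g : Poly n}
    (h : diffOp (linForm η ^ k) (linForm x * g) ∈ linIdeal K) :
    diffOp (linForm η ^ k) g ∈ linIdeal K := by
  rw [linForm_mul_mem_of_diffOp (diffOp_linForm_pow_eq_zero hxη k)] at h
  exact mem_linIdeal_of_linForm_mul_mem hx h

theorem mem_orthogonal_sup_span {S : Submodule ℝ (E n)} {x η : E n} (hη : η ∈ Sᗮ)
    (hx : inner ℝ x η = 0) : η ∈ (S ⊔ ℝ ∙ x)ᗮ := by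
  rw [← Submodule.inf_orthogonal, Submodule.mem_inf,
    Submodule.mem_orthogonal_singleton_iff_inner_right]
  exact ⟨hη, hx⟩

theorem finrank_sup_span {S : Submodule ℝ (E n)} {x : E n} (hx : x ∉ S) :
    Module.finrank ℝ (S ⊔ ℝ ∙ x : Submodule ℝ (E n)) = Module.finrank ℝ S + 1 := by
  have h := Submodule.finrank_sup_add_finrank_inf_eq S (ℝ ∙ x)
  have hx0 : x ≠ 0 := fun h0 => hx (h0 ▸ S.zero_mem)
  rw [((Submodule.disjoint_span_singleton' hx0).2 hx).eq_bot, finrank_bot,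
    finrank_span_singleton hx0] at h
  simpa using h

/-- If `x` lies in the flat, `p_x` is constant for the operator and cancels; if not, the commutator
lowers the order by one, as does the count of vectors outside. Deletion may also lower the total
rank, so `hperp` first treats the directions orthogonal to everything left. -/
theorem MinorKer.delete {x : ι} (hxT : x ∉ T) (hx : X x ∉ spanOf X (A : Set ι)) {g : Poly n}
    (h : MinorKer X II (insert x T) A (linForm (X x) * g)) : MinorKer X II T A g := by
  have hins : ∀ s : Finset ι, spanOf X ((A ∪ insert x s : Finset ι) : Set ι) =
      spanOf X ((A ∪ s : Finset ι) : Set ι) ⊔ ℝ ∙ X x := fun s => by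
    rw [Finset.union_insert, spanOf_insert]
  have hsub : ∀ {s : Finset ι}, s ⊆ T → s ⊆ insert x T := fun hs =>
    hs.trans (Finset.subset_insert x T)
  have hYT : ∀ {Y}, Y ⊆ T → spanOf X ((A ∪ Y : Finset ι) : Set ι) ≤
      spanOf X ((A ∪ T : Finset ι) : Set ι) := fun hY =>
    spanOf_mono X (Finset.coe_subset.2 (Finset.union_subset_union_right hY))
  have hTmem : ∀ {S : Submodule ℝ (E n)}, spanOf X ((A ∪ T : Finset ι) : Set ι) ≤ S →
      outside X T S = ∅ := fun hS => Finset.eq_empty_of_forall_notMem fun i hi =>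
    (mem_outside.1 hi).2 (hS (mem_spanOf X (by simp [(mem_outside.1 hi).1])))
  have hperp : ∀ ζ ∈ (spanOf X ((A ∪ T : Finset ι) : Set ι))ᗮ,
      diffOp (linForm ζ) g ∈ linIdeal (spanOf X (A : Set ι)) := by
    intro ζ hζ
    rw [← pow_one (linForm ζ)]
    by_cases hxζ : inner ℝ (X x) ζ = 0
    · refine diffOp_pow_mem_of_linForm_mul hx hxζ ?_
      have := h.facet (insert x T) subset_rfl (Nat.le_succ _) ζ
        (by rw [hins]; exact mem_orthogonal_sup_span hζ hxζ)
      rwa [outside_insert_of_mem (mem_spanOf X (by simp)), hTmem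
        (by rw [hins]; exact le_sup_left), Finset.card_empty] at this
    · refine diffOp_linForm_pow_mem_of_succ (orthogonal_spanOf_union_le A T hζ) hxζ ?_
      have hxH : X x ∉ spanOf X ((A ∪ T : Finset ι) : Set ι) := fun hmem =>
        hxζ ((Submodule.mem_orthogonal _ ζ).1 hζ _ hmem)
      have := h.facet T (hsub subset_rfl) (by rw [hins, finrank_sup_span hxH]) ζ hζ
      rwa [card_outside_insert_of_notMem hxT hxH, hTmem le_rfl, Finset.card_empty] at this
  constructor
  · intro Y hY hdim η hη
    have hηK := orthogonal_spanOf_union_le A Y hη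
    by_cases hxH : X x ∈ spanOf X ((A ∪ T : Finset ι) : Set ι)
    · have hH : spanOf X ((A ∪ insert x T : Finset ι) : Set ι) =
          spanOf X ((A ∪ T : Finset ι) : Set ι) := by
        rw [hins]
        exact sup_eq_left.2 ((Submodule.span_singleton_le_iff_mem _ _).2 hxH)
      have h1 := h.facet Y (hsub hY) (by rw [hH]; exact hdim) η hη
      by_cases hxη : inner ℝ (X x) η = 0
      · by_cases hxF : X x ∈ spanOf X ((A ∪ Y : Finset ι) : Set ι)
        · rw [outside_insert_of_mem hxF] at h1
          exact diffOp_pow_mem_of_linForm_mul hx hxη h1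
        -- Here adding `x` to the hyperplane gives the whole span, so `η` is orthogonal to all of it
        -- and `hperp` applies.
        · have htop : spanOf X ((A ∪ Y : Finset ι) : Set ι) ⊔ ℝ ∙ X x =
              spanOf X ((A ∪ T : Finset ι) : Set ι) := by
            refine Submodule.eq_of_le_of_finrank_le (sup_le (hYT hY)
              ((Submodule.span_singleton_le_iff_mem _ _).2 hxH)) ?_
            rwa [finrank_sup_span hxF]
          refine diffOp_linForm_pow_mem_linIdeal_of_le hηK (k := 1) (by omega) ?_
          rw [pow_one]
          refine hperp η ?_
          rw [← htop]
          exact mem_orthogonal_sup_span hη hxη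
      · have hxF : X x ∉ spanOf X ((A ∪ Y : Finset ι) : Set ι) := fun hmem =>
          hxη ((Submodule.mem_orthogonal _ η).1 hη _ hmem)
        rw [card_outside_insert_of_notMem hxT hxF] at h1
        exact diffOp_linForm_pow_mem_of_succ hηK hxη h1
    · obtain ⟨ζ, hζ, hxζ⟩ := exists_mem_orthogonal_inner_ne_zero hxH
      have hxF : X x ∉ spanOf X ((A ∪ Y : Finset ι) : Set ι) := fun hmem => hxH (hYT hY hmem)
      -- The vector `x` is a coloop: the hyperplane of the larger family is `span (A ∪ Y ∪ {x})`.
      -- The scalar `a` makes `η - a ζ` normal to it, and `hperp` absorbs `a ζ`.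
      set a : ℝ := inner ℝ (X x) η / inner ℝ (X x) ζ with ha
      have hζ' : a • ζ ∈ (spanOf X ((A ∪ T : Finset ι) : Set ι))ᗮ := Submodule.smul_mem _ a hζ
      have hη' : η - a • ζ ∈ (spanOf X ((A ∪ Y : Finset ι) : Set ι))ᗮ :=
        sub_mem hη (Submodule.orthogonal_le (hYT hY) hζ')
      have hx' : inner ℝ (X x) (η - a • ζ) = 0 := by
        rw [inner_sub_right, inner_smul_right, ha, div_mul_cancel₀ _ hxζ, sub_self]
      rw [← sub_add_cancel η (a • ζ)]
      refine diffOp_linForm_add_pow_mem (orthogonal_spanOf_union_le A Y hη')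
        (orthogonal_spanOf_union_le A T hζ') _ g (hperp _ hζ') ?_
      have h1 := h.facet (insert x Y) (Finset.insert_subset_insert x hY)
        (by rw [hins, hins, finrank_sup_span hxF, finrank_sup_span hxH]; omega) (η - a • ζ)
        (by rw [hins]; exact mem_orthogonal_sup_span hη' hx')
      refine diffOp_linForm_pow_mem_linIdeal_of_le (orthogonal_spanOf_union_le A Y hη') ?_
        (diffOp_pow_mem_of_linForm_mul hx hx' h1)
      rw [outside_insert_of_mem (mem_spanOf X (by simp))]
      refine Nat.succ_le_succ (Finset.card_le_card (outside_mono subset_rfl ?_))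
      rw [hins]
      exact le_sup_left
  · intro I hI hind hnot q hq
    have h1 := h.flat I (hsub hI) hind hnot
    by_cases hxS : X x ∈ spanOf X ((A ∪ I : Finset ι) : Set ι)
    · rw [outside_insert_of_mem hxS] at h1
      have h2 := h1 q hq
      rw [linForm_mul_mem_of_diffOp (hq.2 _ hxS)] at h2
      exact mem_linIdeal_of_linForm_mul_mem hx h2
    · rw [card_outside_insert_of_notMem hxT hxS] at h1
      exact diffOp_mem_of_homogPerp_succ (spanOf_le_spanOf_union A I) hxS h1 q hq

theorem MinorKer.contract {x : ι} {f : Poly n} (h : MinorKer X II (insert x T) A f) :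
    MinorKer X II T (insert x A) f := by
  have hins : ∀ s : Finset ι, insert x A ∪ s = A ∪ insert x s := fun s => by
    rw [Finset.insert_union, Finset.union_insert]
  have hle : linIdeal (spanOf X (A : Set ι)) ≤ linIdeal (spanOf X ((insert x A : Finset ι) : Set ι)) :=
    linIdeal_mono (spanOf_mono X (by simp))
  have hmem : ∀ s : Finset ι, X x ∈ spanOf X ((A ∪ insert x s : Finset ι) : Set ι) := fun s =>
    mem_spanOf X (by simp)
  constructor
  · intro Y hY hdim η hη
    rw [hins] at hη hdim ⊢
    rw [hins] at hdim
    have := h.facet (insert x Y) (Finset.insert_subset_insert x hY) hdim η hη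
    rw [outside_insert_of_mem (hmem Y)] at this
    exact hle this
  · intro I hI hind hnot q hq
    rw [hins] at hind hnot hq
    rw [← outside_insert_of_mem (hmem I)] at hq
    exact hle (h.flat (insert x I) (Finset.insert_subset_insert x hI) hind hnot q hq)

theorem MinorKer.of_insert {x : ι} (hx : X x ∈ spanOf X (A : Set ι)) {f : Poly n}
    (h : MinorKer X II (insert x T) A f) : MinorKer X II T A f := by
  have hH : spanOf X ((A ∪ insert x T : Finset ι) : Set ι) =
      spanOf X ((A ∪ T : Finset ι) : Set ι) := by
    rw [Finset.union_insert, spanOf_insert]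
    exact sup_eq_left.2 ((Submodule.span_singleton_le_iff_mem _ _).2 (spanOf_le_spanOf_union A T hx))
  constructor
  · intro Y hY hdim η hη
    have := h.facet Y (hY.trans (Finset.subset_insert x T)) (hH ▸ hdim) η hη
    rwa [outside_insert_of_mem (spanOf_le_spanOf_union A Y hx)] at this
  · intro I hI hind hnot q hq
    rw [← outside_insert_of_mem (spanOf_le_spanOf_union A I hx)] at hq
    exact h.flat I (hI.trans (Finset.subset_insert x T)) hind hnot q hq

theorem minorP_le_minorP_insert (x : ι) : minorP X II T A ≤ minorP X II (insert x T) A := by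
  refine Submodule.span_mono ?_
  rintro _ ⟨Y, hY, ⟨I, hI, h⟩, rfl⟩
  exact ⟨Y, hY.trans (Finset.subset_insert x T), ⟨I, hI.trans (Finset.subset_insert x T), h⟩, rfl⟩

theorem minorP_contract_le {x : ι} (hxT : x ∉ T) :
    minorP X II T (insert x A) ≤ minorP X II (insert x T) A := by
  refine Submodule.span_mono ?_
  rintro _ ⟨Y, hY, ⟨I, hI, hAI, hYI⟩, rfl⟩
  refine ⟨Y, hY.trans (Finset.subset_insert x T), ⟨insert x I, Finset.insert_subset_insert x hI,
    ?_, ?_⟩, rfl⟩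
  · rwa [Finset.union_insert, ← Finset.insert_union]
  · rw [Finset.disjoint_insert_right]
    exact ⟨fun h => hxT (hY h), hYI⟩

theorem linForm_mul_mem_minorP {x : ι} (hxT : x ∉ T) {g : Poly n} (hg : g ∈ minorP X II T A) :
    linForm (X x) * g ∈ minorP X II (insert x T) A := by
  induction hg using Submodule.span_induction with
  | mem p hp =>
    obtain ⟨Y, hY, ⟨I, hI, hAI, hYI⟩, rfl⟩ := hp
    refine Submodule.subset_span ⟨insert x Y, Finset.insert_subset_insert x hY,
      ⟨I, hI.trans (Finset.subset_insert x T), hAI, ?_⟩, ?_⟩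
    · rw [Finset.disjoint_insert_left]
      exact ⟨fun h => hxT (hI h), hYI⟩
    · rw [prodForm_insert X fun h => hxT (hY h)]
  | zero => rw [mul_zero]; exact zero_mem _
  | add f g _ _ hf hg => rw [mul_add]; exact add_mem hf hg
  | smul c f _ hf => rw [mul_smul_comm]; exact Submodule.smul_mem _ c hf

/-- With nothing left in `T`, either `A ∈ 𝕀'` and `f` is constant modulo the ideal, or `A ∉ 𝕀'` and
the flat condition with `q = 1` puts `f` in the ideal. A vector in `span A` is dropped; any other is
first contracted and then deleted. -/
theorem MinorKer.mem_sup (hII : IsSemiExternal X II) (T : Finset ι) :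
    ∀ (A : Finset ι) (f : Poly n), Disjoint T A → A ∈ indepSets X → MinorKer X II T A f →
      f ∈ minorP X II T A ⊔ (linIdeal (spanOf X (A : Set ι))).restrictScalars ℂ := by
  induction T using Finset.induction_on with
  | empty =>
    intro A f _ hA hf
    by_cases hAII : A ∈ II
    · have hconst := sub_C_mem_linIdeal (K := spanOf X (A : Set ι)) (f := f) fun ξ hξ => by
        have := hf.facet ∅ subset_rfl (Nat.le_succ _) ξ (by rwa [Finset.union_empty])
        simpa [outside] using this
      rw [← add_sub_cancel (C (eval (complexify 0) f)) f]
      refine Submodule.add_mem_sup ?_ hconst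
      rw [← mul_one (C (eval (complexify 0) f)), ← smul_eq_C_mul]
      exact Submodule.smul_mem _ _ (Submodule.subset_span
        ⟨∅, subset_rfl, ⟨∅, subset_rfl, by rwa [Finset.union_empty], by simp⟩, by simp [prodForm]⟩)
    · refine Submodule.mem_sup_right ?_
      have := hf.flat ∅ subset_rfl (by rwa [Finset.union_empty]) (by rwa [Finset.union_empty]) 1
        ⟨by simpa [outside] using isHomogeneous_one (Fin n) ℂ,
          fun η _ => by simpa using diffOp_linForm_C η 1⟩
      simpa [diffOp_one] using this
  | insert x T hxT ih =>
    intro A f hdisj hA hf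
    rw [Finset.disjoint_insert_left] at hdisj
    by_cases hx : X x ∈ spanOf X (A : Set ι)
    · exact sup_le_sup_right (minorP_le_minorP_insert x) _ (ih A f hdisj.2 hA (hf.of_insert hx))
    · have hA' : insert x A ∈ indepSets X := by
        change LinearIndepOn ℝ X ((insert x A : Finset ι) : Set ι)
        rw [Finset.coe_insert]
        exact LinearIndepOn.insert hA hx
      obtain ⟨h, hh, r', hr', hfr⟩ := Submodule.mem_sup.1 (ih (insert x A) f
        (Finset.disjoint_insert_right.2 ⟨hxT, hdisj.2⟩) hA' hf.contract)
      have hhP := minorP_contract_le hxT hh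
      rw [spanOf_insert] at hr'
      obtain ⟨r, hr, s, hs, rfl⟩ := Submodule.mem_sup.1
        (linIdeal_sup_span_singleton_le _ _ ((Submodule.restrictScalars_mem _ _ _).1 hr'))
      obtain ⟨g, rfl⟩ := Ideal.mem_span_singleton'.1 hs
      -- The contraction determines `f` modulo `p_x`; the quotient `g` is left to the deletion.
      have hg : linForm (X x) * g = f - h - r := by rw [← hfr]; ring
      have hker : MinorKer X II (insert x T) A (linForm (X x) * g) := by
        rw [hg]
        exact (hf.sub (minorKer_of_mem_minorP hII hhP)).sub (minorKer_of_mem_linIdeal hr)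
      obtain ⟨u, hu, w, hw, huw⟩ := Submodule.mem_sup.1 (ih A g hdisj.2 hA (hker.delete hxT hx))
      have hfinal : f = (h + linForm (X x) * u) + (r + linForm (X x) * w) := by
        rw [← hfr, ← huw]; ring
      rw [hfinal]
      exact Submodule.add_mem_sup (add_mem hhP (linForm_mul_mem_minorP hxT hu))
        (add_mem hr (Ideal.mul_mem_left _ _ hw))

end DeletionContraction

/-! ### The identity `𝒫₊ = ker ℐ₊` -/

section Kernel

variable {n : ℕ} {ι : Type*} [Fintype ι] {X : ι → E n} {II : Set (Finset ι)}

theorem numOutside_eq (S : Submodule ℝ (E n)) :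
    numOutside X S = (outside X Finset.univ S).card := by
  rw [numOutside, ← Set.ncard_coe_finset]
  congr 1
  ext i
  simp [mem_outside]

variable [DecidableEq ι]

theorem minorP_univ_empty : minorP X II Finset.univ ∅ = spaceP X II := by
  simp [minorP, spaceP]

theorem mem_idealKer_idealISemi_iff (hXspan : Submodule.span ℝ (Set.range X) = ⊤) {f : Poly n} :
    f ∈ idealKer (idealISemi X II) ↔ MinorKer X II Finset.univ ∅ f := by
  have htop : spanOf X ((Finset.univ : Finset ι) : Set ι) = ⊤ := by
    rw [spanOf, Finset.coe_univ, Set.image_univ, hXspan]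
  have hbot : ∀ p : Poly n, p ∈ linIdeal (spanOf X ((∅ : Finset ι) : Set ι)) ↔ p = 0 := fun p => by
    rw [Finset.coe_empty, spanOf_empty, linIdeal_bot, Ideal.mem_bot]
  rw [idealISemi, mem_idealKer_sup, idealI, mem_idealKer_span, mem_idealKer_span]
  constructor
  · rintro ⟨h1, h2⟩
    constructor
    · intro Y _ hdim η hη
      rw [hbot]
      rw [Finset.empty_union] at hη ⊢
      rw [Finset.empty_union, Finset.empty_union, htop, finrank_top, finrank_euclideanSpace_fin]
        at hdim
      -- `MinorKer` also admits `Y` of full rank, but its only normal is `η = 0`, for which the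
      -- condition is trivial; a normal `η ≠ 0` forces rank `n - 1`.
      rcases eq_or_ne η 0 with rfl | hη0
      · simp [linForm_zero]
      · refine h1 _ ⟨_, η, ⟨⟨Y, rfl⟩, le_antisymm ?_ hdim⟩, hη, hη0, by rw [numOutside_eq]⟩
        have hne : spanOf X (Y : Set ι) ≠ ⊤ := fun h => hη0 (by
          rw [h, Submodule.top_orthogonal_eq_bot] at hη
          exact hη)
        have := Submodule.finrank_lt hne
        rwa [finrank_euclideanSpace_fin] at this
    · intro I _ hind hnot q hq
      rw [hbot]
      rw [Finset.empty_union] at hind hnot hq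
      exact h2 q ⟨I, ⟨hind, hnot⟩, by rwa [numOutside_eq]⟩
  · intro h
    constructor
    · rintro _ ⟨F, η, ⟨⟨Y, rfl⟩, hdim⟩, hη, -, rfl⟩
      have := h.facet Y (Finset.subset_univ Y)
        (by rw [Finset.empty_union, Finset.empty_union, htop, finrank_top,
              finrank_euclideanSpace_fin, hdim]) η (by rwa [Finset.empty_union])
      rwa [hbot, Finset.empty_union, ← numOutside_eq] at this
    · rintro q ⟨I, ⟨hind, hnot⟩, hq⟩
      have := h.flat I (Finset.subset_univ I) (by rwa [Finset.empty_union])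
        (by rwa [Finset.empty_union]) q (by rwa [Finset.empty_union, ← numOutside_eq])
      rwa [hbot] at this

theorem spaceP_eq_idealKer_idealISemi (hXspan : Submodule.span ℝ (Set.range X) = ⊤)
    (hII : IsSemiExternal X II) : spaceP X II = idealKer (idealISemi X II) := by
  ext f
  rw [mem_idealKer_idealISemi_iff hXspan, ← minorP_univ_empty]
  refine ⟨minorKer_of_mem_minorP hII, fun hf => ?_⟩
  have hempty : (∅ : Finset ι) ∈ indepSets X := by
    change LinearIndepOn ℝ X ((∅ : Finset ι) : Set ι)
    simp
  have := hf.mem_sup hII Finset.univ ∅ f (by simp) hempty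
  rwa [Finset.coe_empty, spanOf_empty, linIdeal_bot, Submodule.restrictScalars_bot, sup_bot_eq]
    at this

end Kernel

/-! ### Duality between `𝒫₊` and the kernel of a complementary ideal -/

section Duality

variable {n : ℕ}

theorem pairing_eq_zero_of_mem_idealKer {J : Ideal (Poly n)} {p q : Poly n} (hp : p ∈ J)
    (hq : q ∈ idealKer J) : pairing p q = 0 := by
  rw [pairing_apply, hq p hp, coeff_zero]

/-- If `P` complements an ideal `J`, at least as a spanning set, then the pairing embeds `ker J`
into the dual of `P`. -/
theorem injective_pairing_flip {J : Ideal (Poly n)} {P : Submodule ℂ (Poly n)}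
    (h : J.restrictScalars ℂ ⊔ P = ⊤) :
    Function.Injective (pairing.domRestrict₁₂ P (idealKer J)).flip := by
  rw [injective_iff_map_eq_zero]
  intro q hq
  refine Subtype.ext (eq_zero_of_forall_pairing_eq_zero fun p => ?_)
  obtain ⟨a, ha, b, hb, rfl⟩ := Submodule.mem_sup.1 (h ▸ Submodule.mem_top (x := p))
  have hbq : pairing b (q : Poly n) = 0 := LinearMap.congr_fun hq ⟨b, hb⟩
  rw [map_add, LinearMap.add_apply, hbq, pairing_eq_zero_of_mem_idealKer ha q.2, add_zero]

theorem bijective_pairing {J : Ideal (Poly n)} {P : Submodule ℂ (Poly n)} [Module.Finite ℂ P]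
    [Module.Finite ℂ (idealKer J)] (h : J.restrictScalars ℂ ⊔ P = ⊤)
    (hrank : Module.finrank ℂ P = Module.finrank ℂ (idealKer J)) :
    Function.Bijective (pairing.domRestrict₁₂ P (idealKer J)) := by
  set B := pairing.domRestrict₁₂ P (idealKer J)
  have hsurj : Function.Surjective B.flip :=
    (LinearMap.injective_iff_surjective_of_finrank_eq_finrank
      (by rw [Subspace.dual_finrank_eq, hrank])).1 (injective_pairing_flip h)
  have hinj : Function.Injective B := by
    rw [injective_iff_map_eq_zero]
    intro p hp
    refine (Module.forall_dual_apply_eq_zero_iff ℂ p).1 fun φ => ?_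
    obtain ⟨q, rfl⟩ := hsurj φ
    exact LinearMap.congr_fun hp q
  exact ⟨hinj, (LinearMap.injective_iff_surjective_of_finrank_eq_finrank
      (by rw [Subspace.dual_finrank_eq, hrank])).1 hinj⟩

theorem isCompl_of_injective_pairing {J : Ideal (Poly n)} {P : Submodule ℂ (Poly n)}
    (h : J.restrictScalars ℂ ⊔ P = ⊤)
    (hinj : Function.Injective (pairing.domRestrict₁₂ P (idealKer J))) :
    IsCompl (J.restrictScalars ℂ) P := by
  refine ⟨Submodule.disjoint_def.2 fun p hpJ hpP => ?_, codisjoint_iff.2 h⟩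
  have : (⟨p, hpP⟩ : P) = 0 := (injective_iff_map_eq_zero _).1 hinj _
    (LinearMap.ext fun q => pairing_eq_zero_of_mem_idealKer hpJ q.2)
  exact congrArg Subtype.val this

end Duality

/-! ### Homogeneous parts -/

section Graded

variable {n : ℕ}

theorem isHomogeneous_polyQ {ι : Type*} [Fintype ι] [LinearOrder ι] (X : ι → E n) (I : Finset ι) :
    (polyQ X I).IsHomogeneous (val X I) :=
  isHomogeneous_prodForm X _

/-- A family of homogeneous polynomials that spans `P` contains a spanning family of each
homogeneous part of `P`. -/
theorem span_inf_homogeneousSubmodule {κ : Type*} {Q : κ → Poly n} {d : κ → ℕ}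
    (hQ : ∀ k, (Q k).IsHomogeneous (d k)) (j : ℕ) :
    Submodule.span ℂ (Set.range Q) ⊓ homogeneousSubmodule (Fin n) ℂ j =
      Submodule.span ℂ (Set.range fun k : {k // d k = j} => Q k) := by
  apply le_antisymm
  · rintro p ⟨hp, hpj⟩
    have hself : homogeneousComponent j p = p := by
      rw [homogeneousComponent_of_mem hpj, if_pos rfl]
    rw [← hself]
    have := Submodule.mem_map_of_mem (f := homogeneousComponent j) hp
    rw [Submodule.map_span] at this
    refine Submodule.span_le.2 ?_ this
    rintro _ ⟨_, ⟨k, rfl⟩, rfl⟩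
    rw [homogeneousComponent_of_mem (hQ k)]
    split_ifs with h
    · exact Submodule.subset_span ⟨⟨k, h.symm⟩, rfl⟩
    · exact zero_mem _
  · refine Submodule.span_le.2 ?_
    rintro _ ⟨⟨k, rfl⟩, rfl⟩
    exact ⟨Submodule.subset_span ⟨k, rfl⟩, hQ k⟩

end Graded

end Zonotopal

/-! ### The chain of inequalities and the conclusion -/

theorem theorem2p6 {n : ℕ} {ι : Type*} [Fintype ι] [LinearOrder ι]
    (X : ι → Zonotopal.E n) (hX0 : ∀ i, X i ≠ 0)
    (hXspan : Submodule.span ℝ (Set.range X) = ⊤)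
    (B₀ : Module.Basis (Fin n) ℝ (Zonotopal.E n))
    (II : Set (Finset ι)) (hII : Zonotopal.IsSemiExternal X II) :
    -- the polynomials `Q_I` form a basis, which determines the Hilbert series
    (LinearIndependent ℂ (fun I : II => Zonotopal.polyQ X (I : Finset ι)) ∧
      Submodule.span ℂ (Set.range fun I : II => Zonotopal.polyQ X (I : Finset ι)) =
        Zonotopal.spaceP X II ∧
      Module.finrank ℂ (Zonotopal.spaceP X II) = II.ncard ∧
      ∀ j : ℕ, Module.finrank ℂ
          (Zonotopal.spaceP X II ⊓ MvPolynomial.homogeneousSubmodule (Fin n) ℂ j :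
            Submodule ℂ (Zonotopal.Poly n)) =
        {I | I ∈ II ∧ Zonotopal.val X I = j}.ncard) ∧
    -- the kernel of the ideal `𝒥₊` is the least space of the vertices
    ((∀ c : ι ⊕ Fin n → ℝ, Zonotopal.IsSimpleArrangement (Zonotopal.augment X B₀) c →
        Zonotopal.spaceD X B₀ II = Zonotopal.leastSpace (Zonotopal.vertices X B₀ c II)) ∧
      Module.Finite ℂ (Zonotopal.spaceD X B₀ II) ∧
      Module.finrank ℂ (Zonotopal.spaceD X B₀ II) = II.ncard) ∧
    -- the direct sum decomposition of the polynomial ring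
    IsCompl ((Zonotopal.idealJ X B₀ II).restrictScalars ℂ) (Zonotopal.spaceP X II) ∧
    -- the kernel of the ideal `ℐ₊`
    Zonotopal.spaceP X II = Zonotopal.idealKer (Zonotopal.idealISemi X II) ∧
    -- the pairing is an isomorphism onto the dual space
    Function.Bijective
      (Zonotopal.pairing.domRestrict₁₂ (Zonotopal.spaceP X II) (Zonotopal.spaceD X B₀ II)) := by
  open Zonotopal in
  have := Fintype.ofFinite II
  have hcardII : Fintype.card II = II.ncard := by
    rw [← Nat.card_eq_fintype_card, Nat.card_coe_set_eq]
  have hspan := span_polyQ hII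
  have hfinP : Module.Finite ℂ (spaceP X II) := by
    rw [← hspan]
    exact Module.Finite.span_of_finite ℂ (Set.finite_range _)
  have hPle : Module.finrank ℂ (spaceP X II) ≤ II.ncard := by
    rw [← hspan, ← hcardII]
    exact finrank_range_le_card _
  have hsup := idealJ_sup_spaceP B₀ hII
  have hinj := injective_pairing_flip hsup
  have hfinD : Module.Finite ℂ (spaceD X B₀ II) := Module.Finite.of_injective _ hinj
  have hDP : Module.finrank ℂ (spaceD X B₀ II) ≤ Module.finrank ℂ (spaceP X II) := by
    rw [← Subspace.dual_finrank_eq (K := ℂ) (V := spaceP X II)]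
    exact LinearMap.finrank_le_finrank_of_injective hinj
  have hleD : ∀ c, IsSimpleArrangement (augment X B₀) c →
      II.ncard ≤ Module.finrank ℂ (spaceD X B₀ II) := fun c hc =>
    ncard_le_finrank_of_leastSpace_vertices_le hII.1 hc _ (leastSpace_vertices_le_spaceD hII.1 hc)
  -- The dimensions do not depend on `c`, so a single simple arrangement closes the chain.
  obtain ⟨c₀, hc₀⟩ := exists_isSimpleArrangement (augment X B₀)
  have hD : Module.finrank ℂ (spaceD X B₀ II) = II.ncard :=
    le_antisymm (hDP.trans hPle) (hleD c₀ hc₀)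
  have hP : Module.finrank ℂ (spaceP X II) = II.ncard := le_antisymm hPle (hD ▸ hDP)
  have hli : LinearIndependent ℂ (fun I : II => polyQ X (I : Finset ι)) := by
    rw [linearIndependent_iff_card_eq_finrank_span, Set.finrank, hspan, hP, hcardII]
  have hfinD' : Module.Finite ℂ (idealKer (idealJ X B₀ II)) := hfinD
  have hbij := bijective_pairing hsup (hP.trans hD.symm)
  refine ⟨⟨hli, hspan, hP, fun j => ?_⟩, ⟨fun c hc => ?_, hfinD, hD⟩,
    isCompl_of_injective_pairing hsup hbij.1, spaceP_eq_idealKer_idealISemi hXspan hII, hbij⟩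
  · rw [← hspan, span_inf_homogeneousSubmodule (d := fun I : II => val X (I : Finset ι))
      (fun I => isHomogeneous_polyQ X I)]
    have hlij := hli.comp (fun I : {I : II // val X (I : Finset ι) = j} => (I : II))
      Subtype.val_injective
    have := finrank_span_eq_card hlij
    rw [Function.comp_def] at this
    rw [this, ← Nat.card_eq_fintype_card, ← Nat.card_coe_set_eq]
    exact Nat.card_congr (Equiv.subtypeSubtypeEquivSubtypeInter (· ∈ II) fun I => val X I = j)
  · have hle := leastSpace_vertices_le_spaceD (B₀ := B₀) hII.1 hc
    have hfin : Module.Finite ℂ (leastSpace (vertices X B₀ c II)) :=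
      Submodule.finiteDimensional_of_le hle
    -- The least space lies in `𝒟₊` and already has dimension at least `#𝕀' = dim 𝒟₊`.
    refine (Submodule.eq_of_le_of_finrank_le hle ?_).symm
    rw [hD]
    exact ncard_le_finrank_of_leastSpace_vertices_le hII.1 hc _ le_rfl
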